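/- **Setting.** Let $X\subset\mathbb R^d$ with its Borel $\sigma$-algebra, let $(\rho_t)_{t\ge 0}$ be the transition semigroup of a time-homogeneous Markov process on $X$ (for example, of the solution of an SDE $dX_t=b(X_t)\,dt+\sigma(X_t)\,dW_t$), that is, Markov kernels with $\rho_0(x,\cdot)=\delta_x$ and the Chapman–Kolmogorov equations, and let $\mu$ be an invariant probability measure, $\int\rho_t(x,A)\,d\mu(x)=\mu(A)$ for all $t\ge 0$. Fix $t>0$ and let $K^t$ be the Koopman operator on $L^2_\mu(X)$ (real-valued functions), $(K^t\psi)(x)=\int\psi(y)\,\rho_t(x,dy)$. Let $\mathbb 1$ be the constant function, $Q$ the orthogonal projection of $L^2_\mu(X)$ onto $\mathbb 1^\perp$, and $K^t_0$ the restriction of $K^t$ to its invariant subspace $\mathbb 1^\perp$. Let $k:X\times X\to\mathbb R$ be a continuous, symmetric, positive (semi)definite kernel, $\mathbb H$ its reproducing kernel Hilbert space, $\Phi(x)=k(x,\cdot)\in\mathbb H$, and $\varphi(x)=k(x,x)$. Assume: $\varphi\in L^2_\mu$; if $\psi\in L^2_\mu$ and $\iint k(x,y)\psi(x)\psi(y)\,d\mu(x)\,d\mu(y)=0$,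 then $\psi=0$; if $\psi\in\mathbb H$ vanishes $\mu$-a.e., then $\psi=0$. Put $$C_{xy}\psi=\psi(y)\Phi(x)\quad(\psi\in\mathbb H),\qquad C^t_{\mathbb H}=\iint C_{xy}\,\rho_t(x,dy)\,d\mu(x),\qquad \widehat C^{m,t}_{\mathbb H}=\frac1m\sum_{k=0}^{m-1}C_{x_k,y_k}\quad(m\ge1)$$ for data $(x_k,y_k)$, $k=0,\dots,m-1$, obtained by one of two sampling schemes: * **Case (1)** (i.i.d.): the pairs $(x_k,y_k)$ are independent, $x_k\sim\mu$, and $y_k\mid(x_k=x)\sim\rho_t(x,\cdot)$. * **Case (2)** (sliding window): $x_k=X_{kt}$ and $y_k=X_{(k+1)t}$ for one trajectory of the Markov process $(X_s)_{s\ge0}$ with transition semigroup $(\rho_s)$ and $X_0\sim\mu$; $\mu$ is ergodic (for every $s>0$, each Borel set $A$ with $\rho_s(x,A)=1$ for all $x\in A$ has $\mu(A)\in\{0,1\}$); and $1$ belongs to the resolvent set of $K^t_0$. A Mercer basis is an orthonormal basis $(e_j)$ of $L^2_\mu$ of eigenfunctions of $\mathcal E^*\mathcal E$ with eigenvalues $\lambda_j>0$,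 where $\mathcal E\psi=\int\psi(x)\Phi(x)\,d\mu(x)\in\mathbb H$ and $\mathcal E^*:\mathbb H\to L^2_\mu$ is the inclusion; put $f_j=\sqrt{\lambda_j}\,e_j$. **Theorem 3.1.** The integral defining $C^t_{\mathbb H}$ converges absolutely, $C^t_{\mathbb H}$ is a Hilbert–Schmidt operator, and the following hold, with $\mathbb E_0(t):=\langle K^t\varphi,\varphi\rangle_\mu-\|C^t_{\mathbb H}\|_{HS}^2$. (a) In both cases (for sliding-window data even without ergodicity and the resolvent condition), all expectations below are of integrable random variables and $$\mathbb E\big[\|\widehat C^{m,t}_{\mathbb H}-C^t_{\mathbb H}\|^2_{HS}\big]=\frac1m\Big[\mathbb E_0(t)+2\sum_{k=1}^{m-1}\tfrac{m-k}{m}\,\mathbb E\big[\langle C_{x_k,y_k}-C^t_{\mathbb H},\,C_{x_0,y_0}-C^t_{\mathbb H}\rangle_{HS}\big]\Big].$$ (b) In case (1), $\ \mathbb E\big[\|\widehat C^{m,t}_{\mathbb H}-C^t_{\mathbb H}\|^2_{HS}\big]=\frac1m\,\mathbb E_0(t)$. (c) In case (2), for every Mercer basis, the functions $g_{ij}=f_j\cdot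 K^tf_i$ and $g^*_{ji}=f_i\cdot(K^t)^*f_j$ belong to $L^2_\mu$, and $$\mathbb E\big[\|\widehat C^{m,t}_{\mathbb H}-C^t_{\mathbb H}\|^2_{HS}\big]=\frac1m\Big[\mathbb E_0(t)+\sum_{i,j}\big\langle Qg^*_{ji},\,F_m(K^t_0)\,Qg_{ij}\big\rangle_\mu\Big]$$ with an absolutely convergent double series, where $$F_m(z)=2\sum_{k=1}^{m-1}\tfrac{m-k}{m}\,z^{k-1}=\frac{2}{1-z}\Big(1-\frac{1-z^m}{m(1-z)}\Big),\qquad z\in\mathbb C\setminus\{1\},$$ and, with $T=K^t_0$, correspondingly $F_m(T)=2(I-T)^{-1}\big(I-\tfrac1m(I-T)^{-1}(I-T^m)\big)$. -/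

import Mathlib

open MeasureTheory ProbabilityTheory Polynomial
open scoped NNReal ENNReal InnerProductSpace

namespace KoopmanRKHS

noncomputable section

/-! ### Markov processes -/

/-- A (time-homogeneous) transition semigroup `(ρ_t)_{t ≥ 0}` on `X`: Markov kernels with
`ρ_0(x, ·) = δ_x` and the Chapman-Kolmogorov equations. -/
structure TransitionSemigroup (X : Type*) [MeasurableSpace X] where
  ker : ℝ≥0 → Kernel X X
  isMarkovKernel : ∀ t, IsMarkovKernel (ker t)
  ker_zero : ker 0 = Kernel.id
  ker_add : ∀ s t, ker (s + t) = ker t ∘ₖ ker s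

instance {X : Type*} [MeasurableSpace X] (ρ : TransitionSemigroup X) (t : ℝ≥0) :
    IsMarkovKernel (ρ.ker t) := ρ.isMarkovKernel t

/-- `μ` is invariant: `∫ ρ_t(x, A) dμ(x) = μ(A)` for all `t ≥ 0` and all measurable `A`. -/
def IsInvariant {X : Type*} [MeasurableSpace X] (ρ : TransitionSemigroup X) (μ : Measure X) :
    Prop :=
  ∀ t, (ρ.ker t).Invariant μ

/-- `μ` is ergodic: for every `t > 0`, every `ρ_t`-invariant measurable set (that is,
`ρ_t(x, A) = 1` for all `x ∈ A`) has `μ`-measure zero or one. -/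
def IsErgodic {X : Type*} [MeasurableSpace X] (ρ : TransitionSemigroup X) (μ : Measure X) :
    Prop :=
  ∀ t : ℝ≥0, 0 < t → ∀ A : Set X, MeasurableSet A → (∀ x ∈ A, ρ.ker t x A = 1) →
    μ A = 0 ∨ μ A = 1

/-- `(Z_s)_{s ≥ 0}` is a Markov process with transition semigroup `ρ` and initial distribution `ν`:
the conditional distribution of `Z_{s+u}` given the history `(Z_r)_{r ≤ s}` is `ρ_u(Z_s, ·)`. -/
structure IsMarkovProcess {X Ω : Type*} [MeasurableSpace X] [MeasurableSpace Ω]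
    (ρ : TransitionSemigroup X) (ν : Measure X) (P : Measure Ω) (Z : ℝ≥0 → Ω → X) : Prop where
  measurable : ∀ s, Measurable (Z s)
  hasLaw_zero : HasLaw (Z 0) ν P
  markov : ∀ s u : ℝ≥0,
    HasCondDistrib (Z (s + u)) (fun ω (r : Set.Iic s) ↦ Z r ω)
      ((ρ.ker u).comap (fun h : Set.Iic s → X ↦ h ⟨s, Set.self_mem_Iic⟩)
        (measurable_pi_apply _)) P

/-! ### The two sampling schemes, for data `(x_k, y_k)`, `k = 0, …, m - 1` -/

/-- The pairs `(x_k, y_k)` are independent, `x_k ∼ μ`, and `y_k` given `x_k = x` is distributed as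
`κ(x, ·)`. -/
structure IIDSampling {X Ω : Type*} [MeasurableSpace X] [MeasurableSpace Ω]
    (κ : Kernel X X) (μ : Measure X) (P : Measure Ω) (m : ℕ) (x y : ℕ → Ω → X) : Prop where
  indep : iIndepFun (fun (k : Fin m) ω ↦ (x k ω, y k ω)) P
  hasLaw : ∀ k < m, HasLaw (x k) μ P
  condDistrib : ∀ k < m, HasCondDistrib (y k) (x k) κ P

/-- `x_k = Z_{kt}` and `y_k = Z_{(k+1)t}` for one trajectory `Z` of the Markov process started in
the distribution `μ`. -/
def SlidingWindowSampling {X Ω : Type*} [MeasurableSpace X] [MeasurableSpace Ω]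
    (ρ : TransitionSemigroup X) (t : ℝ≥0) (μ : Measure X) (P : Measure Ω) (m : ℕ)
    (x y : ℕ → Ω → X) : Prop :=
  ∃ Z : ℝ≥0 → Ω → X, IsMarkovProcess ρ μ P Z ∧
    ∀ k < m, x k = Z (k * t) ∧ y k = Z ((k + 1) * t)

/-! ### The Koopman operator on `L²(μ)` -/

section Koopman

variable {X : Type*} [MeasurableSpace X]

theorem ae_ae_of_ae {κ : Kernel X X} {μ : Measure X} (hκ : κ.Invariant μ) {p : X → Prop}
    (h : ∀ᵐ y ∂μ, p y) : ∀ᵐ x ∂μ, ∀ᵐ y ∂(κ x), p y := by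
  rw [← hκ.def] at h
  exact Measure.ae_ae_of_ae_bind κ.aemeasurable h

theorem ae_integrable {κ : Kernel X X} [IsMarkovKernel κ] {μ : Measure X}
    (hκ : κ.Invariant μ) {f : X → ℝ} (hf : Integrable f μ) : ∀ᵐ x ∂μ, Integrable f (κ x) := by
  rw [← hκ.def] at hf
  exact Measure.ae_integrable_of_integrable_comp hf

theorem eLpNorm_koopman {κ : Kernel X X} [IsMarkovKernel κ] {μ : Measure X}
    (hκ : κ.Invariant μ) (f : Lp ℝ 2 μ) :
    AEStronglyMeasurable (fun x ↦ ∫ y, f y ∂(κ x)) μ ∧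
      eLpNorm (fun x ↦ ∫ y, f y ∂(κ x)) 2 μ ≤ eLpNorm f 2 μ := by
  have hf : StronglyMeasurable (f : X → ℝ) := Lp.stronglyMeasurable f
  refine ⟨hf.integral_kernel.aestronglyMeasurable, ?_⟩
  have key : ∀ (ν : Measure X) (g : X → ℝ),
      eLpNorm g 2 ν = (∫⁻ x, ‖g x‖ₑ ^ (2 : ℝ) ∂ν) ^ (1 / 2 : ℝ) := by
    intro ν g
    rw [eLpNorm_eq_lintegral_rpow_enorm_toReal (by norm_num) (by norm_num)]
    simp
  have hx : ∀ x, ‖∫ y, f y ∂(κ x)‖ₑ ^ (2 : ℝ) ≤ ∫⁻ y, ‖f y‖ₑ ^ (2 : ℝ) ∂(κ x) := by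
    intro x
    have h1 : ‖∫ y, f y ∂(κ x)‖ₑ ≤ eLpNorm f 2 (κ x) := by
      refine (enorm_integral_le_lintegral_enorm _).trans ?_
      rw [← eLpNorm_one_eq_lintegral_enorm]
      exact eLpNorm_le_eLpNorm_of_exponent_le (by norm_num) hf.aestronglyMeasurable
    calc ‖∫ y, f y ∂(κ x)‖ₑ ^ (2 : ℝ) ≤ (eLpNorm f 2 (κ x)) ^ (2 : ℝ) := by gcongr
      _ = ∫⁻ y, ‖f y‖ₑ ^ (2 : ℝ) ∂(κ x) := by
        rw [key, ← ENNReal.rpow_mul]; norm_num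
  rw [key, key]
  gcongr ?_ ^ _
  calc ∫⁻ x, ‖∫ y, f y ∂(κ x)‖ₑ ^ (2 : ℝ) ∂μ
      ≤ ∫⁻ x, ∫⁻ y, ‖f y‖ₑ ^ (2 : ℝ) ∂(κ x) ∂μ := lintegral_mono hx
    _ = ∫⁻ y, ‖f y‖ₑ ^ (2 : ℝ) ∂(μ.bind κ) :=
        (Measure.lintegral_bind κ.aemeasurable (by fun_prop)).symm
    _ = ∫⁻ y, ‖f y‖ₑ ^ (2 : ℝ) ∂μ := by rw [hκ.def]

theorem memLp_koopman {κ : Kernel X X} [IsMarkovKernel κ] {μ : Measure X}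
    (hκ : κ.Invariant μ) (f : Lp ℝ 2 μ) : MemLp (fun x ↦ ∫ y, f y ∂(κ x)) 2 μ :=
  ⟨(eLpNorm_koopman hκ f).1, (eLpNorm_koopman hκ f).2.trans_lt (Lp.eLpNorm_lt_top f)⟩

variable {μ : Measure X} [IsProbabilityMeasure μ]

theorem integrable_Lp (f : Lp ℝ 2 μ) : Integrable f μ :=
  (Lp.memLp f).integrable (by norm_num)

/-- The Koopman operator `(K ψ)(x) = ∫ ψ(y) κ(x, dy)` on `L²(μ)`, for an invariant probability
measure `μ` of the Markov kernel `κ`. -/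
def koopman (κ : Kernel X X) [IsMarkovKernel κ] (hκ : κ.Invariant μ) :
    Lp ℝ 2 μ →L[ℝ] Lp ℝ 2 μ :=
  LinearMap.mkContinuous
    { toFun := fun f ↦ MemLp.toLp (fun x ↦ ∫ y, f y ∂(κ x)) (memLp_koopman hκ f)
      map_add' := by
        intro f g
        rw [← MemLp.toLp_add, MemLp.toLp_eq_toLp_iff]
        filter_upwards [ae_ae_of_ae hκ (Lp.coeFn_add f g), ae_integrable hκ (integrable_Lp f),
          ae_integrable hκ (integrable_Lp g)] with x h hf hg
        rw [integral_congr_ae h]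
        exact integral_add hf hg
      map_smul' := by
        intro c f
        rw [RingHom.id_apply, ← MemLp.toLp_const_smul, MemLp.toLp_eq_toLp_iff]
        filter_upwards [ae_ae_of_ae hκ (Lp.coeFn_smul c f)] with x h
        rw [integral_congr_ae h]
        exact integral_smul c _ }
    1 (by
      intro f
      rw [one_mul, LinearMap.coe_mk, AddHom.coe_mk, Lp.norm_toLp, Lp.norm_def]
      exact ENNReal.toReal_mono (Lp.eLpNorm_ne_top f) (eLpNorm_koopman hκ f).2)

theorem koopman_ae_eq (κ : Kernel X X) [IsMarkovKernel κ] (hκ : κ.Invariant μ) (f : Lp ℝ 2 μ) :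
    koopman κ hκ f =ᵐ[μ] fun x ↦ ∫ y, f y ∂(κ x) :=
  MemLp.coeFn_toLp (memLp_koopman hκ f)

variable (μ) in
/-- The constant function `𝟙` as an element of `L²(μ)`. -/
def oneL2 : Lp ℝ 2 μ := MemLp.toLp (fun _ : X ↦ (1 : ℝ)) (memLp_const 1)

variable (μ) in
/-- `L²₀(μ) = 𝟙^⊥`, the orthogonal complement of the constants in `L²(μ)`. -/
abbrev L2zero : Submodule ℝ (Lp ℝ 2 μ) := (Submodule.span ℝ {oneL2 μ})ᗮ

variable (μ) in
/-- `Q`, the orthogonal projection of `L²(μ)` onto `𝟙^⊥`. -/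
abbrev projQ : Lp ℝ 2 μ →L[ℝ] L2zero μ := (L2zero μ).orthogonalProjectionOnto

theorem mem_L2zero_iff (f : Lp ℝ 2 μ) : f ∈ L2zero μ ↔ ∫ x, f x ∂μ = 0 := by
  rw [Submodule.mem_orthogonal_singleton_iff_inner_right, L2.inner_def]
  have : ∫ x, ⟪oneL2 μ x, f x⟫_ℝ ∂μ = ∫ x, f x ∂μ := by
    refine integral_congr_ae ?_
    filter_upwards [MemLp.coeFn_toLp (memLp_const (1 : ℝ) (μ := μ) (p := 2))] with x hx
    have : oneL2 μ x = 1 := hx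
    simp [this]
  rw [this]

theorem koopman_mem_L2zero (κ : Kernel X X) [IsMarkovKernel κ] (hκ : κ.Invariant μ)
    (f : L2zero μ) : koopman κ hκ f ∈ L2zero μ := by
  have hf := (mem_L2zero_iff f.1).1 f.2
  rw [mem_L2zero_iff, integral_congr_ae (koopman_ae_eq κ hκ f.1)]
  have hi : Integrable (f.1 : X → ℝ) (κ ∘ₘ μ) := by
    rw [hκ.def]; exact integrable_Lp f.1
  have h1 := hi
  rw [Measure.comp_eq_comp_const_apply] at h1
  have h2 := Kernel.integral_comp h1
  rw [← Measure.comp_eq_comp_const_apply, hκ.def, Kernel.const_apply, hf] at h2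
  exact h2.symm

/-- `K₀`, the restriction of the Koopman operator to `𝟙^⊥`. -/
def koopmanZero (κ : Kernel X X) [IsMarkovKernel κ] (hκ : κ.Invariant μ) :
    L2zero μ →L[ℝ] L2zero μ :=
  (koopman κ hκ ∘L (L2zero μ).subtypeL).codRestrict (L2zero μ) (koopman_mem_L2zero κ hκ)

end Koopman

/-! ### The reproducing kernel Hilbert space -/

section RKHS

variable {X : Type*} (H : Type*) [NormedAddCommGroup H] [InnerProductSpace ℝ H] [CompleteSpace H]
  [RKHS ℝ H X ℝ]

/-- The feature map `Φ(x)`: the element of `H` with `⟪ψ, Φ(x)⟫ = ψ(x)` for all `ψ ∈ H`. -/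
def feature (x : X) : H := RKHS.kerFun H x 1

/-- `H` is the reproducing kernel Hilbert space of `k`, i.e. `Φ(x) = k(x, ·)` for all `x`. -/
def IsRKHSOf (k : X → X → ℝ) : Prop := ∀ x y, feature H x y = k x y

/-- The rank-one operator `C_{xy} ψ = ⟪ψ, Φ(y)⟫ Φ(x) = ψ(y) Φ(x)` on `H`. -/
def rankOneOp (x y : X) : H →L[ℝ] H := InnerProductSpace.rankOne ℝ (feature H x) (feature H y)

variable [MeasurableSpace X]

/-- The compatibility assumptions: `φ(x) = k(x, x)` is in `L²(μ)`; the integral form of `k` is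
definite on `L²(μ)`; an element of `H` that vanishes `μ`-a.e. vanishes everywhere. -/
structure Compatible (k : X → X → ℝ) (μ : Measure X) : Prop where
  memLp_diag : MemLp (fun x ↦ k x x) 2 μ
  eq_zero_of_integral : ∀ ψ : Lp ℝ 2 μ, ∫ x, ∫ y, k x y * ψ x * ψ y ∂μ ∂μ = 0 → ψ = 0
  eq_zero_of_ae : ∀ ψ : H, (∀ᵐ x ∂μ, ψ x = 0) → ∀ x, ψ x = 0

/-- The integral operator `𝓔 ψ = ∫ ψ(x) Φ(x) dμ(x)` from `L²(μ)` to `H` (a Bochner integral, which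
converges as soon as `φ` is integrable). -/
def embedOp {μ : Measure X} (ψ : Lp ℝ 2 μ) : H := ∫ x, ψ x • feature H x ∂μ

/-- The cross-covariance operator `C_H = ∫ C_{xy} κ(x, dy) dμ(x)`. -/
def crossCov (κ : Kernel X X) (μ : Measure X) : H →L[ℝ] H :=
  ∫ z, rankOneOp H z.1 z.2 ∂(μ ⊗ₘ κ)

/-- The empirical estimator `(1/m) ∑_{k<m} C_{x_k, y_k}` at the sample point `ω`. -/
def empCrossCov {Ω : Type*} (m : ℕ) (x y : ℕ → Ω → X) (ω : Ω) : H →L[ℝ] H :=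
  (m : ℝ)⁻¹ • ∑ k ∈ Finset.range m, rankOneOp H (x k ω) (y k ω)

variable {H}

/-- A Mercer basis: an orthonormal basis `(e_j)` of `L²(μ)` consisting of eigenfunctions of
`𝓔* 𝓔` with eigenvalues `λ_j > 0`; here `𝓔*` is the inclusion of `H` into `L²(μ)`, so that the
eigenvalue equation says that the function `𝓔 e_j ∈ H` coincides `μ`-a.e. with `λ_j e_j`. -/
structure IsMercerBasis {ι : Type*} (H : Type*) [NormedAddCommGroup H] [InnerProductSpace ℝ H]
    [CompleteSpace H] [RKHS ℝ H X ℝ] {μ : Measure X} (e : HilbertBasis ι ℝ (Lp ℝ 2 μ))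
    (lam : ι → ℝ) : Prop where
  pos : ∀ j, 0 < lam j
  eigen : ∀ j, ∀ᵐ x ∂μ, embedOp H (e j) x = lam j * e j x

/-- `f_j = √λ_j e_j`, as an element of `L²(μ)`. -/
def mercerFun {ι : Type*} {μ : Measure X} (e : HilbertBasis ι ℝ (Lp ℝ 2 μ)) (lam : ι → ℝ) (j : ι) :
    Lp ℝ 2 μ := √(lam j) • e j

variable {μ : Measure X} [IsProbabilityMeasure μ]

/-- `g_{ij} = f_j · K f_i`. -/
def gFun {ι : Type*} (κ : Kernel X X) [IsMarkovKernel κ] (hκ : κ.Invariant μ)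
    (f : ι → Lp ℝ 2 μ) (i j : ι) : X → ℝ :=
  fun x ↦ f j x * koopman κ hκ (f i) x

/-- `gStarFun κ hκ f j i` is `g*_{ji} = f_i · K* f_j`. -/
def gStarFun {ι : Type*} (κ : Kernel X X) [IsMarkovKernel κ] (hκ : κ.Invariant μ)
    (f : ι → Lp ℝ 2 μ) (j i : ι) : X → ℝ :=
  fun x ↦ f i x * ContinuousLinearMap.adjoint (koopman κ hκ) (f j) x

end RKHS

/-! ### Hilbert-Schmidt inner product and norm -/

section HilbertSchmidt

variable {β H : Type*} [NormedAddCommGroup H] [InnerProductSpace ℝ H]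

/-- `S` is a Hilbert-Schmidt operator, tested on the orthonormal basis `b`. -/
def IsHilbertSchmidt (b : HilbertBasis β ℝ H) (S : H →L[ℝ] H) : Prop :=
  Summable fun i ↦ ‖S (b i)‖ ^ 2

/-- The Hilbert-Schmidt inner product `∑_i ⟪S b_i, T b_i⟫`, computed in the orthonormal basis `b`
(for Hilbert-Schmidt operators the value does not depend on `b`). -/
def hsInner (b : HilbertBasis β ℝ H) (S T : H →L[ℝ] H) : ℝ := ∑' i, ⟪S (b i), T (b i)⟫_ℝ

/-- The squared Hilbert-Schmidt norm `∑_i ‖S b_i‖²`, computed in the orthonormal basis `b`. -/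
def hsNormSq (b : HilbertBasis β ℝ H) (S : H →L[ℝ] H) : ℝ := ∑' i, ‖S (b i)‖ ^ 2

end HilbertSchmidt

/-- The number `𝔼₀ = ⟪K φ, φ⟫_μ - ‖C_H‖²_HS`, where `φ(x) = k(x, x)`. -/
def EZero {X β H : Type*} [MeasurableSpace X] [NormedAddCommGroup H] [InnerProductSpace ℝ H]
    [CompleteSpace H] [RKHS ℝ H X ℝ] (b : HilbertBasis β ℝ H) {k : X → X → ℝ} {μ : Measure X}
    [IsProbabilityMeasure μ] (hk : MemLp (fun x ↦ k x x) 2 μ)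
    (κ : Kernel X X) [IsMarkovKernel κ] (hκ : κ.Invariant μ) : ℝ :=
  ⟪koopman κ hκ (hk.toLp _), hk.toLp _⟫_ℝ - hsNormSq b (crossCov H κ μ)

/-- The polynomial `F_m(z) = 2 ∑_{k=1}^{m-1} ((m-k)/m) z^{k-1}`. -/
def Fpoly (m : ℕ) : ℝ[X] :=
  C 2 * ∑ k ∈ Finset.Ico 1 m, C (((m : ℝ) - k) / m) * X ^ (k - 1)

end

end KoopmanRKHS

open KoopmanRKHS

/-! Record a Hilbert–Schmidt operator by its values on `b`, a point of the Hilbert space ℓ²(β, H).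
There C_{xy} becomes the vector `crossLp`, with ⟪C_{xy}, C_{x'y'}⟫ = k(x,x') k(y,y')
(`inner_crossLp`). Its squared norm φ(x)φ(y) is integrable because φ ∈ L² and both marginals of the
pair law are μ. The estimator is thus a mean of m square-integrable vectors with common expectation
C. In its second moment the covariances depend only on the lag; lag zero occurs m times and lag l >
0 occurs 2(m-l) times, which is the formula of (a) (`integral_norm_avg_sub_sq`). The lag-zero term
is 𝔼₀ (`EZero_eq`), and under independence the others vanish.

For the sliding window, two pairs at lag l are linked by the Markov kernel over time (l-1)t. A
Mercer basis yields an orthonormal basis F_j of H representing the f_j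
(`IsMercerBasis.exists_hilbertBasis`), and Parseval expands the covariance into moments of f_j(x)
f_i(y) f_j(x') f_i(y'). Integrating out the latest times first and moving the operator of the first
pair to the other side as an adjoint turns such a moment into ⟪g*_{ji}, (K^t)^{l-1} g_{ij}⟫
(`integral_chainLaw`). Since K^t fixes 𝟙, subtracting the product of the means amounts to inserting
Q (`inner_projQ_pow`). The weighted sum over l is then F_m(K₀). That g_{ij} and g*_{ji} lie in L²
rests on a Cauchy–Schwarz inequality for positive operators (`sq_le_of_positive`). The closed form
of F_m is a polynomial identity (`Fpoly_mul`). -/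

namespace KoopmanRKHS

/-! ### The polynomial F_m and Toeplitz sums. -/

section Algebra

/-- Raising m by one raises every coefficient by one, so the sum grows by a geometric sum, which one
factor 1 - X telescopes. -/
theorem sum_Ico_sub_mul_pow (m : ℕ) :
    (1 - X) ^ 2 * ∑ k ∈ Finset.Ico 1 (m + 1), C ((m : ℝ) + 1 - k) * X ^ (k - 1) =
      C ((m : ℝ) + 1) * (1 - X) - (1 - X ^ (m + 1) : ℝ[X]) := by
  induction m with
  | zero => simp
  | succ m ih =>
    have hgeom : (1 - X) * ∑ k ∈ Finset.Ico 1 (m + 2), (X ^ (k - 1) : ℝ[X]) = 1 - X ^ (m + 1) := by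
      rw [Finset.sum_Ico_eq_sum_range]
      simp only [Nat.add_sub_cancel_left, Nat.add_one_sub_one]
      exact mul_neg_geom_sum X (m + 1)
    have hsplit : ∑ k ∈ Finset.Ico 1 (m + 2), C (((m + 1 : ℕ) : ℝ) + 1 - k) * X ^ (k - 1) =
        ∑ k ∈ Finset.Ico 1 (m + 1), C ((m : ℝ) + 1 - k) * X ^ (k - 1) +
          ∑ k ∈ Finset.Ico 1 (m + 2), (X ^ (k - 1) : ℝ[X]) := by
      -- The range may be extended because the new top coefficient, at k = m + 1, is zero.
      have h0 : ∑ k ∈ Finset.Ico 1 (m + 1), C ((m : ℝ) + 1 - k) * X ^ (k - 1) =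
          ∑ k ∈ Finset.Ico 1 (m + 2), C ((m : ℝ) + 1 - k) * (X ^ (k - 1) : ℝ[X]) := by
        rw [Finset.sum_Ico_succ_top (by omega : 1 ≤ m + 1)]
        simp
      rw [h0, ← Finset.sum_add_distrib]
      refine Finset.sum_congr rfl fun k _ ↦ ?_
      rw [show ((m + 1 : ℕ) : ℝ) + 1 - k = ((m : ℝ) + 1 - k) + 1 by push_cast; ring]
      simp only [map_add, map_one]
      ring
    rw [hsplit, mul_add, ih, pow_two, mul_assoc, hgeom]
    simp only [Nat.cast_add, Nat.cast_one, map_add, map_one]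
    ring

/-- The closed form with denominators cleared: a single identity in ℝ[X] can be evaluated both at
complex numbers and at operators. -/
theorem Fpoly_mul (m : ℕ) (hm : 1 ≤ m) :
    (1 - X) ^ 2 * Fpoly m = C 2 * ((1 - X) - C (m : ℝ)⁻¹ * (1 - X ^ m)) := by
  obtain ⟨n, rfl⟩ : ∃ n, m = n + 1 := ⟨m - 1, by omega⟩
  have hn : ((n + 1 : ℕ) : ℝ) ≠ 0 := by positivity
  have h1 : Fpoly (n + 1) = C 2 * (C ((n + 1 : ℕ) : ℝ)⁻¹ *
      ∑ k ∈ Finset.Ico 1 (n + 1), C ((n : ℝ) + 1 - k) * X ^ (k - 1)) := by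
    rw [Fpoly, Finset.mul_sum _ _ (C ((n + 1 : ℕ) : ℝ)⁻¹)]
    congr 1
    refine Finset.sum_congr rfl fun k _ ↦ ?_
    rw [← mul_assoc, ← C_mul]
    congr 2
    push_cast
    ring
  have hC : C ((n + 1 : ℕ) : ℝ)⁻¹ * C ((n : ℝ) + 1) = 1 := by
    rw [← C_mul, ← C_1]
    congr 1
    push_cast at hn ⊢
    field_simp
  calc (1 - X) ^ 2 * Fpoly (n + 1)
      = C 2 * C ((n + 1 : ℕ) : ℝ)⁻¹ *
        ((1 - X) ^ 2 * ∑ k ∈ Finset.Ico 1 (n + 1), C ((n : ℝ) + 1 - k) * X ^ (k - 1)) := by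
        rw [h1]; ring
    _ = C 2 * ((C ((n + 1 : ℕ) : ℝ)⁻¹ * C ((n : ℝ) + 1)) * (1 - X) -
          C ((n + 1 : ℕ) : ℝ)⁻¹ * (1 - X ^ (n + 1))) := by
        rw [sum_Ico_sub_mul_pow]; ring
    _ = _ := by rw [hC, one_mul]

theorem aeval_Fpoly_complex (m : ℕ) (hm : 1 ≤ m) (z : ℂ) (hz : z ≠ 1) :
    aeval z (Fpoly m) = 2 / (1 - z) * (1 - (1 - z ^ m) / (m * (1 - z))) := by
  have h := congrArg (aeval z) (Fpoly_mul m hm)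
  have hz' : 1 - z ≠ 0 := sub_ne_zero.2 hz.symm
  have hm' : (m : ℂ) ≠ 0 := by exact_mod_cast (by omega : m ≠ 0)
  simp only [map_mul, map_pow, map_sub, map_one, aeval_X, aeval_C] at h
  simp only [Complex.coe_algebraMap, Complex.ofReal_ofNat, Complex.ofReal_inv,
    Complex.ofReal_natCast] at h
  field_simp at h ⊢
  linear_combination h

theorem aeval_Fpoly_of_isUnit {A : Type*} [Ring A] [Algebra ℝ A] (m : ℕ) (hm : 1 ≤ m) (T : A)
    (hT : IsUnit (1 - T)) :
    aeval T (Fpoly m) = (2 : ℝ) • (Ring.inverse (1 - T) *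
      (1 - (m : ℝ)⁻¹ • (Ring.inverse (1 - T) * (1 - T ^ m)))) := by
  have h := congrArg (aeval T) (Fpoly_mul m hm)
  simp only [map_mul, map_pow, map_sub, map_one, aeval_X, aeval_C] at h
  have hi : Ring.inverse (1 - T) * (1 - T) = 1 := Ring.inverse_mul_cancel _ hT
  have h2 : aeval T (Fpoly m) =
      Ring.inverse (1 - T) * (Ring.inverse (1 - T) * ((1 - T) ^ 2 * aeval T (Fpoly m))) := by
    rw [pow_two, mul_assoc (1 - T), ← mul_assoc (Ring.inverse (1 - T)) (1 - T), hi, one_mul,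
      ← mul_assoc, hi, one_mul]
  rw [h2, h, ← Algebra.smul_def, ← Algebra.smul_def, mul_smul_comm, mul_smul_comm, mul_sub, hi,
    mul_smul_comm]

/-- A symmetric Toeplitz double sum. -/
theorem sum_sum_toeplitz (m : ℕ) (c : ℕ → ℕ → ℝ) (a : ℕ → ℝ) (hsymm : ∀ k l, c k l = c l k)
    (hc : ∀ k j, k + j < m → c (k + j) k = a j) :
    ∑ k ∈ Finset.range m, ∑ l ∈ Finset.range m, c k l =
      m * a 0 + 2 * ∑ j ∈ Finset.Ico 1 m, ((m : ℝ) - j) * a j := by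
  induction m with
  | zero => simp
  | succ m ih =>
    -- The new row, read backwards from the diagonal, contains each lag 1, …, m once.
    have h1 : ∑ l ∈ Finset.range m, c m l = ∑ j ∈ Finset.Ico 1 (m + 1), a j := by
      rw [Finset.sum_Ico_eq_sum_range, ← Finset.sum_range_reflect, Nat.add_sub_cancel]
      refine Finset.sum_congr rfl fun l hl ↦ ?_
      have hl := Finset.mem_range.1 hl
      rw [← hc (m - 1 - l) (1 + l) (by omega)]
      congr 1
      omega
    have h2 : ∑ k ∈ Finset.range m, c k m = ∑ l ∈ Finset.range m, c m l :=
      Finset.sum_congr rfl fun k _ ↦ hsymm k m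
    have h3 : ∑ j ∈ Finset.Ico 1 (m + 1), (((m + 1 : ℕ) : ℝ) - j) * a j =
        ∑ j ∈ Finset.Ico 1 m, ((m : ℝ) - j) * a j + ∑ j ∈ Finset.Ico 1 (m + 1), a j := by
      have h0 : ∑ j ∈ Finset.Ico 1 m, ((m : ℝ) - j) * a j =
          ∑ j ∈ Finset.Ico 1 (m + 1), ((m : ℝ) - j) * a j := by
        rcases Nat.eq_zero_or_pos m with rfl | hpos
        · simp
        · rw [Finset.sum_Ico_succ_top hpos]; simp
      rw [h0, ← Finset.sum_add_distrib]
      refine Finset.sum_congr rfl fun j _ ↦ ?_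
      push_cast
      ring
    rw [Finset.sum_range_succ]
    simp only [Finset.sum_range_succ _ m]
    rw [Finset.sum_add_distrib, ih fun k j h ↦ hc k j (by omega), h2, h1, h3,
      show a 0 = c m m from (hc m 0 (by omega)).symm]
    push_cast
    ring

end Algebra

/-! ### Hilbert–Schmidt operators as elements of ℓ²(β, H). -/

section HilbertSchmidtModel

/-- ‖f z - f y‖² is a combination of inner products, so it tends to 0 as z → y. This transfers
continuity of k to Φ and to `crossLp`. -/
theorem continuous_of_continuous_inner {Y E : Type*} [TopologicalSpace Y] [NormedAddCommGroup E]
    [InnerProductSpace ℝ E] {f : Y → E} (hf : Continuous fun p : Y × Y ↦ ⟪f p.1, f p.2⟫_ℝ) :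
    Continuous f := by
  rw [continuous_iff_continuousAt]
  intro y
  rw [ContinuousAt, tendsto_iff_norm_sub_tendsto_zero]
  have h : Continuous fun z ↦ ⟪f z, f z⟫_ℝ - 2 * ⟪f z, f y⟫_ℝ + ⟪f y, f y⟫_ℝ := by
    have h1 : Continuous fun z ↦ ⟪f z, f z⟫_ℝ := hf.comp (by fun_prop : Continuous fun z ↦ (z, z))
    have h2 : Continuous fun z ↦ ⟪f z, f y⟫_ℝ := hf.comp (by fun_prop : Continuous fun z ↦ (z, y))
    fun_prop
  have h3 : (fun z ↦ ‖f z - f y‖) =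
      fun z ↦ √(⟪f z, f z⟫_ℝ - 2 * ⟪f z, f y⟫_ℝ + ⟪f y, f y⟫_ℝ) := by
    ext z
    rw [← Real.sqrt_sq (norm_nonneg (f z - f y)), norm_sub_sq_real, ← real_inner_self_eq_norm_sq,
      ← real_inner_self_eq_norm_sq]
  rw [h3]
  have h4 := (Real.continuous_sqrt.comp h).tendsto y
  have h5 : √(⟪f y, f y⟫_ℝ - 2 * ⟪f y, f y⟫_ℝ + ⟪f y, f y⟫_ℝ) = 0 := by
    rw [show ⟪f y, f y⟫_ℝ - 2 * ⟪f y, f y⟫_ℝ + ⟪f y, f y⟫_ℝ = 0 by ring, Real.sqrt_zero]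
  rw [Function.comp_apply, h5] at h4
  exact h4

variable {β H : Type*} [NormedAddCommGroup H] [InnerProductSpace ℝ H]

theorem memℓp_two_iff {ι : Type*} {E : Type*} [NormedAddCommGroup E] (f : ι → E) :
    Memℓp f 2 ↔ Summable fun i ↦ ‖f i‖ ^ 2 := by
  rw [memℓp_gen_iff (by norm_num)]
  simp

theorem memℓp_rankOne (b : HilbertBasis β ℝ H) (u v : H) :
    Memℓp (fun i ↦ InnerProductSpace.rankOne ℝ u v (b i)) 2 := by
  rw [memℓp_two_iff]
  have h := (b.summable_inner_mul_inner v v).mul_right (‖u‖ ^ 2)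
  refine h.congr fun i ↦ ?_
  rw [InnerProductSpace.rankOne_apply, norm_smul, mul_pow, Real.norm_eq_abs, sq_abs,
    real_inner_comm v (b i), pow_two ⟪v, b i⟫_ℝ]

/-- The rank-one operator `w ↦ ⟪v, w⟫ u` as an element of the Hilbert space `ℓ²(β, H)` of
Hilbert-Schmidt operators. -/
noncomputable def rankOneLp (b : HilbertBasis β ℝ H) (u v : H) : lp (fun _ : β ↦ H) 2 :=
  ⟨fun i ↦ InnerProductSpace.rankOne ℝ u v (b i), memℓp_rankOne b u v⟩

theorem rankOneLp_apply (b : HilbertBasis β ℝ H) (u v : H) (i : β) :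
    rankOneLp b u v i = InnerProductSpace.rankOne ℝ u v (b i) := rfl

/-- The factor ⟪u, u'⟫ comes out of the sum, and Parseval sums the rest. -/
theorem inner_rankOneLp (b : HilbertBasis β ℝ H) (u v u' v' : H) :
    ⟪rankOneLp b u v, rankOneLp b u' v'⟫_ℝ = ⟪u, u'⟫_ℝ * ⟪v, v'⟫_ℝ := by
  rw [lp.inner_eq_tsum, ← b.tsum_inner_mul_inner v v', ← tsum_mul_left]
  refine tsum_congr fun i ↦ ?_
  rw [rankOneLp_apply, rankOneLp_apply, InnerProductSpace.rankOne_apply,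
    InnerProductSpace.rankOne_apply, real_inner_smul_left, real_inner_smul_right,
    real_inner_comm v' (b i)]
  ring

/-- Agreement on the basis vectors is all that is needed to pass to ℓ²(β, H); no isometry between
operators and sequences has to be set up. -/
theorem hsInner_eq_inner (b : HilbertBasis β ℝ H) {S T : H →L[ℝ] H} {s t : lp (fun _ : β ↦ H) 2}
    (hs : ∀ i, S (b i) = s i) (ht : ∀ i, T (b i) = t i) : hsInner b S T = ⟪s, t⟫_ℝ := by
  simp only [hsInner, lp.inner_eq_tsum, hs, ht]

theorem hsNormSq_eq_norm_sq (b : HilbertBasis β ℝ H) {S : H →L[ℝ] H} {s : lp (fun _ : β ↦ H) 2}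
    (hs : ∀ i, S (b i) = s i) : hsNormSq b S = ‖s‖ ^ 2 := by
  simp only [← real_inner_self_eq_norm_sq, hsNormSq, lp.inner_eq_tsum, hs]

theorem isHilbertSchmidt_of_lp (b : HilbertBasis β ℝ H) {S : H →L[ℝ] H}
    {s : lp (fun _ : β ↦ H) 2} (hs : ∀ i, S (b i) = s i) : IsHilbertSchmidt b S := by
  simp only [IsHilbertSchmidt, hs]
  exact (memℓp_two_iff _).1 (lp.memℓp s)

/-- Orthonormal vectors are √2 > 1 apart, so balls of radius 1/2 around them are disjoint. -/
theorem countable_of_orthonormal {E ι : Type*} [NormedAddCommGroup E] [InnerProductSpace ℝ E]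
    [TopologicalSpace.SeparableSpace E] {v : ι → E} (hv : Orthonormal ℝ v) : Countable ι := by
  refine Pairwise.countable_of_isOpen_disjoint (s := fun i ↦ Metric.ball (v i) (1 / 2)) ?_
    (fun i ↦ Metric.isOpen_ball) (fun i ↦ ⟨v i, Metric.mem_ball_self (by norm_num)⟩)
  intro i j hij
  refine Metric.ball_disjoint_ball ?_
  rw [dist_eq_norm]
  have h : ‖v i - v j‖ ^ 2 = 2 := by
    rw [norm_sub_sq_real, hv.1 i, hv.1 j, hv.2 hij]; norm_num
  nlinarith [norm_nonneg (v i - v j)]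

end HilbertSchmidtModel

/-! ### The feature map and the vectors C_{xy}. -/

section Feature

variable {X H : Type*} [NormedAddCommGroup H] [InnerProductSpace ℝ H] [CompleteSpace H]
  [RKHS ℝ H X ℝ]

theorem inner_feature (ψ : H) (x : X) : ⟪ψ, feature H x⟫_ℝ = ψ x := by
  simp [feature]

variable {k : X → X → ℝ}

theorem inner_feature_feature (hH : IsRKHSOf H k) (x y : X) :
    ⟪feature H x, feature H y⟫_ℝ = k x y := by
  rw [inner_feature, hH]

theorem norm_feature_sq (hH : IsRKHSOf H k) (x : X) : ‖feature H x‖ ^ 2 = k x x := by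
  rw [← real_inner_self_eq_norm_sq, inner_feature_feature hH]

theorem sq_apply_le (hH : IsRKHSOf H k) (ψ : H) (x : X) : ψ x ^ 2 ≤ ‖ψ‖ ^ 2 * k x x := by
  rw [← inner_feature, ← norm_feature_sq hH, ← mul_pow, ← sq_abs]
  exact pow_le_pow_left₀ (abs_nonneg _) (abs_real_inner_le_norm _ _) 2

theorem diag_nonneg (hH : IsRKHSOf H k) (x : X) : 0 ≤ k x x := by
  rw [← norm_feature_sq hH]; positivity

variable [TopologicalSpace X]

theorem continuous_feature (hH : IsRKHSOf H k) (hk : Continuous (Function.uncurry k)) :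
    Continuous (feature H : X → H) := by
  refine continuous_of_continuous_inner ?_
  simp only [inner_feature_feature hH]
  exact hk

theorem continuous_apply (hH : IsRKHSOf H k) (hk : Continuous (Function.uncurry k)) (ψ : H) :
    Continuous (ψ : X → ℝ) := by
  have h : Continuous fun x : X ↦ ⟪ψ, feature H x⟫_ℝ :=
    continuous_const.inner (continuous_feature hH hk)
  simpa only [inner_feature] using h

/-- The continuous image Φ(X) is separable and its span is dense: a ψ orthogonal to every Φ(x)
vanishes pointwise. -/
theorem separableSpace_of_continuous [TopologicalSpace.SeparableSpace X] (hH : IsRKHSOf H k)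
    (hk : Continuous (Function.uncurry k)) : TopologicalSpace.SeparableSpace H := by
  have h1 : TopologicalSpace.IsSeparable (Set.range (feature H : X → H)) :=
    TopologicalSpace.isSeparable_range (continuous_feature hH hk)
  have h2 : (Submodule.span ℝ (Set.range (feature H : X → H))).topologicalClosure = ⊤ := by
    rw [Submodule.topologicalClosure_eq_top_iff, Submodule.eq_bot_iff]
    intro ψ hψ
    refine RKHS.ext fun x ↦ ?_
    rw [← inner_feature, real_inner_comm]
    simpa using hψ _ (Submodule.subset_span ⟨x, rfl⟩)
  have h3 : TopologicalSpace.IsSeparable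
      (closure (Submodule.span ℝ (Set.range (feature H : X → H)) : Set H)) := h1.span.closure
  rw [← Submodule.topologicalClosure_coe, h2, Submodule.top_coe] at h3
  exact TopologicalSpace.isSeparable_univ_iff.1 h3

/-- The operator `C_{xy}` as an element of the Hilbert space `ℓ²(β, H)`. -/
noncomputable def crossLp {β : Type*} (b : HilbertBasis β ℝ H) (p : X × X) :
    lp (fun _ : β ↦ H) 2 :=
  rankOneLp b (feature H p.1) (feature H p.2)

variable {β : Type*} (b : HilbertBasis β ℝ H)

omit [TopologicalSpace X] in
theorem inner_crossLp (hH : IsRKHSOf H k) (p q : X × X) :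
    ⟪crossLp b p, crossLp b q⟫_ℝ = k p.1 q.1 * k p.2 q.2 := by
  rw [crossLp, crossLp, inner_rankOneLp, inner_feature_feature hH, inner_feature_feature hH]

omit [TopologicalSpace X] in
theorem norm_crossLp_sq (hH : IsRKHSOf H k) (p : X × X) :
    ‖crossLp b p‖ ^ 2 = k p.1 p.1 * k p.2 p.2 := by
  rw [← real_inner_self_eq_norm_sq, inner_crossLp b hH]

theorem continuous_crossLp (hH : IsRKHSOf H k) (hk : Continuous (Function.uncurry k)) :
    Continuous (crossLp b : X × X → _) := by
  refine continuous_of_continuous_inner ?_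
  simp only [inner_crossLp b hH]
  have h1 : Continuous fun p : (X × X) × (X × X) ↦ k p.1.1 p.2.1 :=
    hk.comp (by fun_prop : Continuous fun p : (X × X) × (X × X) ↦ (p.1.1, p.2.1))
  have h2 : Continuous fun p : (X × X) × (X × X) ↦ k p.1.2 p.2.2 :=
    hk.comp (by fun_prop : Continuous fun p : (X × X) × (X × X) ↦ (p.1.2, p.2.2))
  exact h1.mul h2

theorem continuous_rankOneOp (hH : IsRKHSOf H k) (hk : Continuous (Function.uncurry k)) :
    Continuous fun p : X × X ↦ rankOneOp H p.1 p.2 := by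
  have h := continuous_feature hH hk
  exact (InnerProductSpace.rankOne ℝ (E := H) (F := H)).continuous₂.comp
    ((h.comp continuous_fst).prodMk (h.comp continuous_snd))

end Feature

/-! ### Second moments of Hilbert-space-valued means. -/

section SecondMoment

variable {Ω G : Type*} [MeasurableSpace Ω] {P : Measure Ω} [NormedAddCommGroup G]
  [InnerProductSpace ℝ G]

theorem integrable_inner_of_memLp {f g : Ω → G} (hf : MemLp f 2 P) (hg : MemLp g 2 P) :
    Integrable (fun ω ↦ ⟪f ω, g ω⟫_ℝ) P := by
  refine (hf.norm.integrable_mul hg.norm).mono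
    (hf.aestronglyMeasurable.inner hg.aestronglyMeasurable) (ae_of_all _ fun ω ↦ ?_)
  simpa using norm_inner_le_norm (𝕜 := ℝ) (f ω) (g ω)

variable [IsProbabilityMeasure P]

/-- The second moment of the deviation of an empirical mean, for a sequence with stationary
covariances. -/
theorem integral_norm_avg_sub_sq (m : ℕ) (hm : 1 ≤ m) (Z : ℕ → Ω → G) (c : G)
    (hZ : ∀ k < m, MemLp (Z k) 2 P)
    (hstat : ∀ k j, k + j < m → ∫ ω, ⟪Z (k + j) ω - c, Z k ω - c⟫_ℝ ∂P =
      ∫ ω, ⟪Z j ω - c, Z 0 ω - c⟫_ℝ ∂P) :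
    Integrable (fun ω ↦ ‖(m : ℝ)⁻¹ • ∑ k ∈ Finset.range m, Z k ω - c‖ ^ 2) P ∧
      ∫ ω, ‖(m : ℝ)⁻¹ • ∑ k ∈ Finset.range m, Z k ω - c‖ ^ 2 ∂P =
        1 / m * (∫ ω, ‖Z 0 ω - c‖ ^ 2 ∂P + 2 * ∑ l ∈ Finset.Ico 1 m, ((m : ℝ) - l) / m *
          ∫ ω, ⟪Z l ω - c, Z 0 ω - c⟫_ℝ ∂P) := by
  have hm0 : (m : ℝ) ≠ 0 := by exact_mod_cast (by omega : m ≠ 0)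
  have hY : ∀ k < m, MemLp (fun ω ↦ Z k ω - c) 2 P := fun k hk ↦ (hZ k hk).sub (memLp_const c)
  have hI : ∀ k ∈ Finset.range m, ∀ l ∈ Finset.range m,
      Integrable (fun ω ↦ ⟪Z k ω - c, Z l ω - c⟫_ℝ) P := fun k hk l hl ↦
    integrable_inner_of_memLp (hY k (Finset.mem_range.1 hk)) (hY l (Finset.mem_range.1 hl))
  have hexp : (fun ω ↦ ‖(m : ℝ)⁻¹ • ∑ k ∈ Finset.range m, Z k ω - c‖ ^ 2) = fun ω ↦
      ((m : ℝ)⁻¹) ^ 2 * ∑ k ∈ Finset.range m, ∑ l ∈ Finset.range m,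
        ⟪Z k ω - c, Z l ω - c⟫_ℝ := by
    ext ω
    -- Centring the mean is the same as centring each summand; this needs m ≠ 0.
    have h1 : (m : ℝ)⁻¹ • ∑ k ∈ Finset.range m, Z k ω - c =
        (m : ℝ)⁻¹ • ∑ k ∈ Finset.range m, (Z k ω - c) := by
      rw [Finset.sum_sub_distrib, smul_sub, Finset.sum_const, Finset.card_range,
        ← Nat.cast_smul_eq_nsmul ℝ, smul_smul, inv_mul_cancel₀ hm0, one_smul]
    rw [h1, norm_smul, mul_pow, Real.norm_eq_abs, sq_abs, ← real_inner_self_eq_norm_sq, sum_inner]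
    simp only [inner_sum]
  rw [hexp]
  have hInt : Integrable (fun ω ↦ ∑ k ∈ Finset.range m, ∑ l ∈ Finset.range m,
      ⟪Z k ω - c, Z l ω - c⟫_ℝ) P :=
    integrable_finsetSum _ fun k hk ↦ integrable_finsetSum _ fun l hl ↦ hI k hk l hl
  refine ⟨hInt.const_mul _, ?_⟩
  rw [integral_const_mul, integral_finsetSum _ fun k hk ↦ integrable_finsetSum _ fun l hl ↦
    hI k hk l hl, Finset.sum_congr rfl fun k hk ↦ integral_finsetSum _ fun l hl ↦ hI k hk l hl,
    sum_sum_toeplitz m (fun k l ↦ ∫ ω, ⟪Z k ω - c, Z l ω - c⟫_ℝ ∂P)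
      (fun j ↦ ∫ ω, ⟪Z j ω - c, Z 0 ω - c⟫_ℝ ∂P)
      (fun k l ↦ integral_congr_ae (ae_of_all _ fun ω ↦ real_inner_comm _ _)) hstat]
  simp only [real_inner_self_eq_norm_sq]
  have h2 : ∑ l ∈ Finset.Ico 1 m, ((m : ℝ) - l) / m * ∫ ω, ⟪Z l ω - c, Z 0 ω - c⟫_ℝ ∂P =
      (m : ℝ)⁻¹ * ∑ l ∈ Finset.Ico 1 m, ((m : ℝ) - l) * ∫ ω, ⟪Z l ω - c, Z 0 ω - c⟫_ℝ ∂P := by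
    rw [Finset.mul_sum]
    exact Finset.sum_congr rfl fun l _ ↦ by ring
  rw [h2]
  field_simp

variable [CompleteSpace G]

/-- Both f(p) and f(q) have mean c, so each cross term contributes ‖c‖², whatever the coupling of p
and q. -/
theorem integral_inner_sub_integral {Y : Type*} [MeasurableSpace Y] {π : Measure Y}
    [IsProbabilityMeasure π] {f : Y → G} (hf : MemLp f 2 π) {p q : Ω → Y}
    (hp : MeasurePreserving p P π) (hq : MeasurePreserving q P π) :
    ∫ ω, ⟪f (p ω) - ∫ z, f z ∂π, f (q ω) - ∫ z, f z ∂π⟫_ℝ ∂P =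
      ∫ ω, ⟪f (p ω), f (q ω)⟫_ℝ ∂P - ‖∫ z, f z ∂π‖ ^ 2 := by
  set c := ∫ z, f z ∂π with hc
  have h1 : MemLp (fun ω ↦ f (p ω)) 2 P := hf.comp_measurePreserving hp
  have h2 : MemLp (fun ω ↦ f (q ω)) 2 P := hf.comp_measurePreserving hq
  have hfi : Integrable f π := hf.integrable (by norm_num)
  have i1 := integrable_inner_of_memLp h1 h2
  have i2 := integrable_inner_of_memLp h1 (memLp_const c)
  have i3 := integrable_inner_of_memLp (memLp_const c) h2
  have e : ∀ r : Ω → Y, MeasurePreserving r P π → ∫ ω, f (r ω) ∂P = c := fun r hr ↦ by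
    rw [hc, ← hr.map_eq, integral_map hr.measurable.aemeasurable
      (by rw [hr.map_eq]; exact hf.aestronglyMeasurable)]
  have e2 : ∫ ω, ⟪f (p ω), c⟫_ℝ ∂P = ‖c‖ ^ 2 := by
    simp only [real_inner_comm c]
    rw [integral_inner (h1.integrable (by norm_num)), e p hp, real_inner_self_eq_norm_sq]
  have e3 : ∫ ω, ⟪c, f (q ω)⟫_ℝ ∂P = ‖c‖ ^ 2 := by
    rw [integral_inner (h2.integrable (by norm_num)), e q hq, real_inner_self_eq_norm_sq]
  have h3 : ∀ ω, ⟪f (p ω) - c, f (q ω) - c⟫_ℝ =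
      ⟪f (p ω), f (q ω)⟫_ℝ - ⟪f (p ω), c⟫_ℝ - ⟪c, f (q ω)⟫_ℝ + ‖c‖ ^ 2 := fun ω ↦ by
    rw [inner_sub_left, inner_sub_right, inner_sub_right, real_inner_self_eq_norm_sq]
    ring
  have i12 : Integrable (fun ω ↦ ⟪f (p ω), f (q ω)⟫_ℝ - ⟪f (p ω), c⟫_ℝ) P := i1.sub i2
  have i123 : Integrable (fun ω ↦ ⟪f (p ω), f (q ω)⟫_ℝ - ⟪f (p ω), c⟫_ℝ - ⟪c, f (q ω)⟫_ℝ) P :=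
    i12.sub i3
  simp only [h3]
  rw [integral_add i123 (integrable_const _), integral_sub i12 i3, integral_sub i1 i2, e2, e3]
  simp

/-- Fubini. It serves twice: it kills the covariances of independent pairs, and it writes ‖C‖² as a
mixed moment that can be expanded in a basis. -/
theorem integral_inner_prod {Y : Type*} [MeasurableSpace Y] {π : Measure Y}
    [IsProbabilityMeasure π] {f : Y → G} (hf : MemLp f 2 π) :
    ∫ z, ⟪f z.2, f z.1⟫_ℝ ∂(π.prod π) = ‖∫ z, f z ∂π‖ ^ 2 := by
  have h1 : MemLp (fun z : Y × Y ↦ f z.1) 2 (π.prod π) :=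
    hf.comp_measurePreserving measurePreserving_fst
  have h2 : MemLp (fun z : Y × Y ↦ f z.2) 2 (π.prod π) :=
    hf.comp_measurePreserving measurePreserving_snd
  have hfi : Integrable f π := hf.integrable (by norm_num)
  rw [integral_prod _ (integrable_inner_of_memLp h2 h1)]
  have h3 : ∀ x, ∫ y, ⟪f y, f x⟫_ℝ ∂π = ⟪∫ z, f z ∂π, f x⟫_ℝ := fun x ↦ by
    simp only [real_inner_comm (f x)]
    rw [integral_inner hfi]
  simp only [h3]
  rw [integral_inner hfi, real_inner_self_eq_norm_sq]

end SecondMoment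

/-! ### Laws of one pair and of two pairs. -/

section Laws

variable {X Ω : Type*} [MeasurableSpace X] [MeasurableSpace Ω] {P : Measure Ω}
  [IsProbabilityMeasure P] {μ : Measure X} [IsProbabilityMeasure μ]

theorem measurePreserving_fst_compProd {Y : Type*} [MeasurableSpace Y] (κ : Kernel X Y)
    [IsMarkovKernel κ] : MeasurePreserving Prod.fst (μ ⊗ₘ κ) μ :=
  ⟨measurable_fst, Measure.fst_compProd μ κ⟩

theorem measurePreserving_snd_compProd {κ : Kernel X X} [IsMarkovKernel κ] (hκ : κ.Invariant μ) :
    MeasurePreserving Prod.snd (μ ⊗ₘ κ) μ :=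
  ⟨measurable_snd, by rw [← Measure.snd, Measure.snd_compProd, hκ.def]⟩

omit [IsProbabilityMeasure P] [IsProbabilityMeasure μ] in
theorem IIDSampling.hasLaw_pair {κ : Kernel X X} [IsMarkovKernel κ] {m : ℕ} {x y : ℕ → Ω → X}
    (h : IIDSampling κ μ P m x y) {k : ℕ} (hk : k < m) :
    HasLaw (fun ω ↦ (x k ω, y k ω)) (μ ⊗ₘ κ) P :=
  (h.hasLaw k hk).prodMk_of_hasCondDistrib (h.condDistrib k hk)

omit [IsProbabilityMeasure μ] in
theorem IIDSampling.hasLaw_two_pairs {κ : Kernel X X} [IsMarkovKernel κ] {m : ℕ}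
    {x y : ℕ → Ω → X} (h : IIDSampling κ μ P m x y) {k j : ℕ} (hj : 0 < j) (hk : k + j < m) :
    HasLaw (fun ω ↦ ((x k ω, y k ω), (x (k + j) ω, y (k + j) ω)))
      ((μ ⊗ₘ κ).prod (μ ⊗ₘ κ)) P := by
  have h1 := h.hasLaw_pair (by omega : k < m)
  have h2 := h.hasLaw_pair hk
  have hi := h.indep.indepFun (i := ⟨k, by omega⟩) (j := ⟨k + j, hk⟩) (by simp; omega)
  refine ⟨by fun_prop, ?_⟩
  have := (indepFun_iff_map_prod_eq_prod_map_map h1.aemeasurable h2.aemeasurable).1 hi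
  rw [this, h1.map_eq, h2.map_eq]

/-- The law of `((Z_s, Z_{s+t}), (Z_{s+t+u}, Z_{s+t+u+t}))` for the stationary process `Z`. -/
noncomputable def chainLaw (ρ : TransitionSemigroup X) (t u : ℝ≥0) (μ : Measure X) :
    Measure ((X × X) × (X × X)) :=
  (μ ⊗ₘ ρ.ker t ⊗ₘ (ρ.ker u).comap Prod.snd measurable_snd ⊗ₘ
    (ρ.ker t).comap Prod.snd measurable_snd).map MeasurableEquiv.prodAssoc

variable {ρ : TransitionSemigroup X} {Z : ℝ≥0 → Ω → X}

omit [IsProbabilityMeasure μ] in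
-- The transition kernel depends on the history only through Z_s. If g(history) still determines
-- Z_s, the kernel factors through g, and conditioning on the full history can be replaced by
-- conditioning on g.
theorem IsMarkovProcess.hasLaw_append (hZ : IsMarkovProcess ρ μ P Z) (s u : ℝ≥0) {A : Type*}
    [MeasurableSpace A] (g : (Set.Iic s → X) → A) (hg : Measurable g) (last : A → X)
    (hlast : Measurable last) (h : ∀ w, last (g w) = w ⟨s, Set.self_mem_Iic⟩) {Q : Measure A}
    (hQ : HasLaw (fun ω ↦ g fun r : Set.Iic s ↦ Z r ω) Q P) :
    HasLaw (fun ω ↦ (g (fun r : Set.Iic s ↦ Z r ω), Z (s + u) ω))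
      (Q ⊗ₘ (ρ.ker u).comap last hlast) P := by
  have h1 := hZ.markov s u
  have h2 : (ρ.ker u).comap (fun h : Set.Iic s → X ↦ h ⟨s, Set.self_mem_Iic⟩)
      (measurable_pi_apply _) = ((ρ.ker u).comap last hlast).comap g hg := by
    ext w
    simp [h]
  rw [h2] at h1
  exact hQ.prodMk_of_hasCondDistrib h1.comp_right

theorem IsMarkovProcess.hasLaw_pair (hZ : IsMarkovProcess ρ μ P Z) (hμ : IsInvariant ρ μ)
    (s u : ℝ≥0) : HasLaw (fun ω ↦ (Z s ω, Z (s + u) ω)) (μ ⊗ₘ ρ.ker u) P := by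
  have key : ∀ s u, HasLaw (Z s) μ P → HasLaw (fun ω ↦ (Z s ω, Z (s + u) ω)) (μ ⊗ₘ ρ.ker u) P :=
    fun s u hs ↦ hZ.hasLaw_append s u (fun w ↦ w ⟨s, Set.self_mem_Iic⟩) (measurable_pi_apply _) id
      measurable_id (fun _ ↦ rfl) hs
  refine key s u ?_
  -- Stationarity: Z_s is the second coordinate of the pair started at time 0, so its law is μ by
  -- invariance.
  have h0 := key 0 s hZ.hasLaw_zero
  refine ⟨(hZ.measurable s).aemeasurable, ?_⟩
  have h1 := (measurePreserving_snd_compProd (hμ s)).map_eq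
  rw [← h0.map_eq, AEMeasurable.map_map_of_aemeasurable (by fun_prop) (by fun_prop)] at h1
  simpa [Function.comp_def] using h1

theorem IsMarkovProcess.hasLaw_chain (hZ : IsMarkovProcess ρ μ P Z) (hμ : IsInvariant ρ μ)
    (s t u : ℝ≥0) :
    HasLaw (fun ω ↦ ((Z s ω, Z (s + t) ω), (Z (s + t + u) ω, Z (s + t + u + t) ω)))
      (chainLaw ρ t u μ) P := by
  have h1 := hZ.hasLaw_pair hμ s t
  have h2 := hZ.hasLaw_append (s + t) u
    (fun w ↦ (w ⟨s, by simp⟩, w ⟨s + t, Set.self_mem_Iic⟩)) (by fun_prop) Prod.snd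
    measurable_snd (fun _ ↦ rfl) h1
  have h3 := hZ.hasLaw_append (s + t + u) t
    (fun w ↦ ((w ⟨s, by simp [add_assoc]⟩, w ⟨s + t, by simp⟩),
      w ⟨s + t + u, Set.self_mem_Iic⟩)) (by fun_prop) Prod.snd
    measurable_snd (fun _ ↦ rfl) h2
  refine ⟨?_, ?_⟩
  · have := hZ.measurable
    exact (by fun_prop : Measurable _).aemeasurable
  · rw [chainLaw, ← h3.map_eq, AEMeasurable.map_map_of_aemeasurable
      MeasurableEquiv.prodAssoc.measurable.aemeasurable h3.aemeasurable]
    rfl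

theorem SlidingWindowSampling.hasLaw_pair {t : ℝ≥0} {m : ℕ} {x y : ℕ → Ω → X}
    (h : SlidingWindowSampling ρ t μ P m x y) (hμ : IsInvariant ρ μ) {k : ℕ} (hk : k < m) :
    HasLaw (fun ω ↦ (x k ω, y k ω)) (μ ⊗ₘ ρ.ker t) P := by
  obtain ⟨Z, hZ, hxy⟩ := h
  rw [(hxy k hk).1, (hxy k hk).2, add_mul, one_mul]
  exact hZ.hasLaw_pair hμ _ _

/-- Pair k ends at time (k+1)t and pair k+j starts at (k+j)t, hence the gap (j-1)t; it is zero for j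
= 1, where y_k = x_{k+1}. -/
theorem SlidingWindowSampling.hasLaw_two_pairs {t : ℝ≥0} {m : ℕ} {x y : ℕ → Ω → X}
    (h : SlidingWindowSampling ρ t μ P m x y) (hμ : IsInvariant ρ μ) {k j : ℕ} (hj : 0 < j)
    (hk : k + j < m) :
    HasLaw (fun ω ↦ ((x k ω, y k ω), (x (k + j) ω, y (k + j) ω)))
      (chainLaw ρ t ((j - 1 : ℕ) * t) μ) P := by
  obtain ⟨Z, hZ, hxy⟩ := h
  obtain ⟨i, rfl⟩ : ∃ i, j = i + 1 := ⟨j - 1, by omega⟩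
  rw [(hxy k (by omega)).1, (hxy k (by omega)).2, (hxy _ hk).1, (hxy _ hk).2]
  have := hZ.hasLaw_chain hμ (k * t) t (i * t)
  have e1 : ((k + (i + 1) : ℕ) : ℝ≥0) * t = k * t + t + i * t := by push_cast; ring
  have e2 : (((k + (i + 1) : ℕ) : ℝ≥0) + 1) * t = k * t + t + i * t + t := by push_cast; ring
  rw [e1, e2, add_mul, one_mul]
  exact this

end Laws

/-! ### The Koopman operator: positivity, semigroup law, projection. -/

section KoopmanLemmas

variable {X : Type*} [MeasurableSpace X] {μ : Measure X} [IsProbabilityMeasure μ]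
  {κ : Kernel X X} [IsMarkovKernel κ] (hκ : κ.Invariant μ)

include hκ in
theorem integral_integral_kernel {f : X → ℝ} (hf : Integrable f μ) :
    ∫ x, ∫ y, f y ∂(κ x) ∂μ = ∫ x, f x ∂μ := by
  have h := (measurePreserving_snd_compProd hκ).map_eq
  have hs : AEStronglyMeasurable f ((μ ⊗ₘ κ).map Prod.snd) := by
    rw [h]; exact hf.aestronglyMeasurable
  have hi : Integrable (fun z : X × X ↦ f z.2) (μ ⊗ₘ κ) :=
    (integrable_map_measure hs measurable_snd.aemeasurable).1 (by rw [h]; exact hf)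
  rw [← Measure.integral_compProd hi]
  conv_rhs => rw [← h]
  exact (integral_map measurable_snd.aemeasurable hs).symm

theorem koopman_toLp {f : X → ℝ} (hf : MemLp f 2 μ) :
    koopman κ hκ (hf.toLp f) =ᵐ[μ] fun x ↦ ∫ y, f y ∂(κ x) := by
  filter_upwards [koopman_ae_eq κ hκ (hf.toLp f), ae_ae_of_ae hκ hf.coeFn_toLp] with x h1 h2
  rw [h1, integral_congr_ae h2]

include hκ in
theorem memLp_comp_snd {f : X → ℝ} (hf : MemLp f 2 μ) :
    MemLp (fun z : X × X ↦ f z.2) 2 (μ ⊗ₘ κ) :=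
  hf.comp_measurePreserving (measurePreserving_snd_compProd hκ)

theorem memLp_comp_fst {f : X → ℝ} (hf : MemLp f 2 μ) :
    MemLp (fun z : X × X ↦ f z.1) 2 (μ ⊗ₘ κ) :=
  hf.comp_measurePreserving (measurePreserving_fst_compProd κ)

theorem integrable_mul_compProd {f g : X → ℝ} (hf : MemLp f 2 μ) (hg : MemLp g 2 μ)
    (hκ : κ.Invariant μ) : Integrable (fun z : X × X ↦ f z.1 * g z.2) (μ ⊗ₘ κ) :=
  (memLp_comp_fst hf).integrable_mul (memLp_comp_snd hκ hg)

theorem integral_mul_compProd {f g : X → ℝ} (hf : MemLp f 2 μ) (hg : MemLp g 2 μ) :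
    ∫ z, f z.1 * g z.2 ∂(μ ⊗ₘ κ) = ∫ x, f x * koopman κ hκ (hg.toLp g) x ∂μ := by
  rw [Measure.integral_compProd (integrable_mul_compProd hf hg hκ)]
  refine integral_congr_ae ?_
  filter_upwards [koopman_toLp hκ hg] with x hx
  rw [hx]
  exact integral_const_mul _ _

theorem real_inner_eq_mul (a b : ℝ) : ⟪a, b⟫_ℝ = a * b := by
  rw [RCLike.inner_apply, conj_trivial, mul_comm]

omit [IsProbabilityMeasure μ] in
theorem inner_toLp_left {f : X → ℝ} (hf : MemLp f 2 μ) (g : Lp ℝ 2 μ) :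
    ⟪hf.toLp f, g⟫_ℝ = ∫ x, f x * g x ∂μ := by
  rw [L2.inner_def]
  refine integral_congr_ae ?_
  filter_upwards [hf.coeFn_toLp] with x hx
  rw [hx, real_inner_eq_mul]

omit [IsProbabilityMeasure μ] in
theorem inner_eq_integral_mul (f g : Lp ℝ 2 μ) : ⟪f, g⟫_ℝ = ∫ x, f x * g x ∂μ := by
  rw [L2.inner_def]
  exact integral_congr_ae (ae_of_all _ fun x ↦ real_inner_eq_mul _ _)

omit [IsProbabilityMeasure μ] in
theorem integrable_mul_Lp (f g : Lp ℝ 2 μ) : Integrable (fun x ↦ f x * g x) μ :=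
  (Lp.memLp f).integrable_mul (Lp.memLp g)

theorem oneL2_ae : oneL2 μ =ᵐ[μ] fun _ ↦ 1 := MemLp.coeFn_toLp (memLp_const 1)

theorem inner_oneL2 (f : Lp ℝ 2 μ) : ⟪oneL2 μ, f⟫_ℝ = ∫ x, f x ∂μ := by
  rw [oneL2, inner_toLp_left]
  simp

theorem koopman_oneL2 : koopman κ hκ (oneL2 μ) = oneL2 μ := by
  refine Lp.ext ?_
  filter_upwards [koopman_toLp hκ (memLp_const (1 : ℝ)), oneL2_ae (μ := μ)] with x h1 h2
  rw [h2]
  refine Eq.trans h1 ?_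
  simp

theorem adjoint_koopman_oneL2 :
    ContinuousLinearMap.adjoint (koopman κ hκ) (oneL2 μ) = oneL2 μ := by
  refine ext_inner_right ℝ fun f ↦ ?_
  rw [ContinuousLinearMap.adjoint_inner_left, inner_oneL2, inner_oneL2,
    integral_congr_ae (koopman_ae_eq κ hκ f), integral_integral_kernel hκ (integrable_Lp f)]

theorem koopman_nonneg {f : Lp ℝ 2 μ} (hf : ∀ᵐ x ∂μ, 0 ≤ f x) :
    ∀ᵐ x ∂μ, 0 ≤ koopman κ hκ f x := by
  filter_upwards [koopman_ae_eq κ hκ f, ae_ae_of_ae hκ hf] with x h1 h2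
  rw [h1]
  exact integral_nonneg_of_ae h2

/-- No kernel representing the adjoint is at hand, so positivity is obtained by duality: the
integral of K* f over s is ⟪K 1_s, f⟫ ≥ 0. -/
theorem adjoint_koopman_nonneg {f : Lp ℝ 2 μ} (hf : ∀ᵐ x ∂μ, 0 ≤ f x) :
    ∀ᵐ x ∂μ, 0 ≤ ContinuousLinearMap.adjoint (koopman κ hκ) f x := by
  refine ae_nonneg_of_forall_setIntegral_nonneg (integrable_Lp _) fun s hs _ ↦ ?_
  have hI : MemLp (s.indicator fun _ ↦ (1 : ℝ)) 2 μ := (memLp_const 1).indicator hs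
  have h1 : ∫ x in s, ContinuousLinearMap.adjoint (koopman κ hκ) f x ∂μ =
      ⟪hI.toLp _, ContinuousLinearMap.adjoint (koopman κ hκ) f⟫_ℝ := by
    rw [inner_toLp_left, ← integral_indicator hs]
    refine integral_congr_ae (ae_of_all _ fun x ↦ ?_)
    by_cases hx : x ∈ s <;> simp [hx]
  rw [h1, ContinuousLinearMap.adjoint_inner_right, inner_eq_integral_mul]
  refine integral_nonneg_of_ae ?_
  have h2 : ∀ᵐ x ∂μ, 0 ≤ hI.toLp _ x := by
    filter_upwards [hI.coeFn_toLp] with x hx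
    rw [hx]
    exact Set.indicator_nonneg (fun _ _ ↦ zero_le_one) x
  filter_upwards [koopman_nonneg hκ h2, hf] with x h3 h4
  exact mul_nonneg h3 h4

/-- The Cauchy-Schwarz inequality for a positivity preserving operator that fixes the
constants. -/
theorem sq_le_of_positive (T : Lp ℝ 2 μ →L[ℝ] Lp ℝ 2 μ)
    (hT : ∀ f : Lp ℝ 2 μ, (∀ᵐ x ∂μ, 0 ≤ f x) → ∀ᵐ x ∂μ, 0 ≤ T f x)
    (hT1 : T (oneL2 μ) = oneL2 μ) {f g : Lp ℝ 2 μ} (hfg : ∀ᵐ x ∂μ, f x ^ 2 ≤ g x) :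
    ∀ᵐ x ∂μ, T f x ^ 2 ≤ T g x := by
  -- T is applied to g - 2af + a² ≥ (f - a)² ≥ 0. Rational a keep the exceptional sets countable in
  -- number; density then gives all real a, and a = T f(x) is the optimal choice.
  have h1 : ∀ a : ℚ, ∀ᵐ x ∂μ, 2 * (a : ℝ) * T f x - (a : ℝ) ^ 2 ≤ T g x := by
    intro a
    have h2 : ∀ᵐ x ∂μ, 0 ≤ (g - (2 * (a : ℝ)) • f + ((a : ℝ) ^ 2) • oneL2 μ) x := by
      filter_upwards [hfg, Lp.coeFn_add (g - (2 * (a : ℝ)) • f) (((a : ℝ) ^ 2) • oneL2 μ),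
        Lp.coeFn_sub g ((2 * (a : ℝ)) • f), Lp.coeFn_smul (2 * (a : ℝ)) f,
        Lp.coeFn_smul ((a : ℝ) ^ 2) (oneL2 μ), oneL2_ae (μ := μ)] with x h h3 h4 h5 h6 h7
      rw [h3, Pi.add_apply, h4, Pi.sub_apply, h5, h6, Pi.smul_apply, Pi.smul_apply, h7,
        smul_eq_mul, smul_eq_mul]
      nlinarith [sq_nonneg (f x - a)]
    have h8 := hT _ h2
    rw [map_add, map_sub, map_smul, map_smul, hT1] at h8
    filter_upwards [h8, Lp.coeFn_add (T g - (2 * (a : ℝ)) • T f) (((a : ℝ) ^ 2) • oneL2 μ),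
      Lp.coeFn_sub (T g) ((2 * (a : ℝ)) • T f), Lp.coeFn_smul (2 * (a : ℝ)) (T f),
      Lp.coeFn_smul ((a : ℝ) ^ 2) (oneL2 μ), oneL2_ae (μ := μ)] with x h h3 h4 h5 h6 h7
    rw [h3, Pi.add_apply, h4, Pi.sub_apply, h5, h6, Pi.smul_apply, Pi.smul_apply, h7,
      smul_eq_mul, smul_eq_mul] at h
    linarith
  filter_upwards [ae_all_iff.2 h1] with x hx
  have hclosed : IsClosed {a : ℝ | 2 * a * T f x - a ^ 2 ≤ T g x} :=
    isClosed_le (by fun_prop) continuous_const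
  have h2 : ∀ a : ℝ, 2 * a * T f x - a ^ 2 ≤ T g x := by
    intro a
    have h3 : Set.range ((↑) : ℚ → ℝ) ⊆ {a : ℝ | 2 * a * T f x - a ^ 2 ≤ T g x} := by
      rintro _ ⟨q, rfl⟩
      exact hx q
    have h4 := hclosed.closure_subset_iff.2 h3
    rw [Rat.denseRange_cast.closure_range] at h4
    exact h4 (Set.mem_univ a)
  have := h2 (T f x)
  nlinarith

/-- If `f² ≤ φ` and `g² ≤ φ` with `φ ∈ L²`, then `f · T g ∈ L²` for positivity preserving `T`
fixing the constants. -/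
theorem memLp_mul_of_positive (T : Lp ℝ 2 μ →L[ℝ] Lp ℝ 2 μ)
    (hT : ∀ f : Lp ℝ 2 μ, (∀ᵐ x ∂μ, 0 ≤ f x) → ∀ᵐ x ∂μ, 0 ≤ T f x)
    (hT1 : T (oneL2 μ) = oneL2 μ) {f g φ ψ : Lp ℝ 2 μ} (hf : ∀ᵐ x ∂μ, f x ^ 2 ≤ φ x)
    (hg : ∀ᵐ x ∂μ, g x ^ 2 ≤ ψ x) : MemLp (fun x ↦ f x * T g x) 2 μ := by
  have hm : AEStronglyMeasurable (fun x ↦ f x * T g x) μ :=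
    (Lp.aestronglyMeasurable f).mul (Lp.aestronglyMeasurable (T g))
  rw [memLp_two_iff_integrable_sq hm]
  refine (integrable_mul_Lp φ (T ψ)).mono (hm.pow 2) ?_
  filter_upwards [hf, sq_le_of_positive T hT hT1 hg] with x h1 h2
  rw [Real.norm_eq_abs, Real.norm_eq_abs, abs_of_nonneg (sq_nonneg _), mul_pow]
  exact (mul_le_mul h1 h2 (sq_nonneg _) ((sq_nonneg _).trans h1)).trans (le_abs_self _)

theorem koopman_congr {κ' : Kernel X X} [IsMarkovKernel κ'] (hκ' : κ'.Invariant μ) (h : κ = κ') :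
    koopman κ hκ = koopman κ' hκ' := by
  subst h; rfl

theorem koopman_add {ρ : TransitionSemigroup X} (hμ : IsInvariant ρ μ) (s t : ℝ≥0) :
    koopman (ρ.ker (s + t)) (hμ _) = koopman (ρ.ker s) (hμ _) * koopman (ρ.ker t) (hμ _) := by
  refine ContinuousLinearMap.ext fun f ↦ Lp.ext ?_
  filter_upwards [koopman_ae_eq (ρ.ker (s + t)) (hμ _) f,
    koopman_ae_eq (ρ.ker s) (hμ _) (koopman (ρ.ker t) (hμ _) f),
    ae_ae_of_ae (hμ s) (koopman_ae_eq (ρ.ker t) (hμ _) f),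
    ae_integrable (hμ (s + t)) (integrable_Lp f)] with x h1 h2 h3 h4
  rw [h1, mul_apply_eq_comp, h2, integral_congr_ae h3]
  rw [ρ.ker_add] at h4 ⊢
  exact Kernel.integral_comp h4

theorem koopman_zero {ρ : TransitionSemigroup X} (hμ : IsInvariant ρ μ) :
    koopman (ρ.ker 0) (hμ _) = 1 := by
  refine ContinuousLinearMap.ext fun f ↦ Lp.ext ?_
  filter_upwards [koopman_ae_eq (ρ.ker 0) (hμ _) f] with x h1
  rw [h1, ρ.ker_zero, Kernel.id_apply, integral_dirac' _ _ (Lp.stronglyMeasurable f)]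
  rfl

theorem koopman_nat_mul {ρ : TransitionSemigroup X} (hμ : IsInvariant ρ μ) (t : ℝ≥0) (n : ℕ) :
    koopman (ρ.ker (n * t)) (hμ _) = koopman (ρ.ker t) (hμ _) ^ n := by
  induction n with
  | zero =>
    rw [pow_zero, ← koopman_zero hμ]
    exact koopman_congr _ _ (by simp)
  | succ n ih =>
    rw [pow_succ, ← ih, ← koopman_add hμ]
    exact koopman_congr _ _ (by push_cast; rw [add_mul, one_mul])

theorem koopmanZero_pow_coe (n : ℕ) (f : L2zero μ) :
    ((koopmanZero κ hκ ^ n) f : Lp ℝ 2 μ) = (koopman κ hκ ^ n) f := by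
  induction n with
  | zero => rfl
  | succ n ih =>
    rw [pow_succ', pow_succ', mul_apply_eq_comp, mul_apply_eq_comp, ← ih]
    rfl

theorem koopman_pow_oneL2 (n : ℕ) : (koopman κ hκ ^ n) (oneL2 μ) = oneL2 μ := by
  induction n with
  | zero => rfl
  | succ n ih => rw [pow_succ', mul_apply_eq_comp, ih, koopman_oneL2]

theorem norm_oneL2 : ‖oneL2 μ‖ = 1 := by
  have h : ⟪oneL2 μ, oneL2 μ⟫_ℝ = 1 := by
    rw [inner_oneL2, integral_congr_ae oneL2_ae]; simp
  rw [real_inner_self_eq_norm_sq] at h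
  nlinarith [norm_nonneg (oneL2 μ)]

theorem projQ_coe (f : Lp ℝ 2 μ) : (projQ μ f : Lp ℝ 2 μ) = f - ⟪oneL2 μ, f⟫_ℝ • oneL2 μ := by
  have h := Submodule.starProjection_orthogonal_val (K := Submodule.span ℝ {oneL2 μ}) f
  rw [Submodule.starProjection_unit_singleton ℝ norm_oneL2] at h
  exact h

/-- K fixes 𝟙 and preserves 𝟙^⊥, so removing the constant components costs exactly the product of
the means. -/
theorem inner_projQ_pow (n : ℕ) (f g : Lp ℝ 2 μ) :
    ⟪projQ μ f, (koopmanZero κ hκ ^ n) (projQ μ g)⟫_ℝ =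
      ⟪f, (koopman κ hκ ^ n) g⟫_ℝ - ⟪oneL2 μ, f⟫_ℝ * ⟪oneL2 μ, g⟫_ℝ := by
  have h0 : ⟪oneL2 μ, ((koopmanZero κ hκ ^ n) (projQ μ g) : Lp ℝ 2 μ)⟫_ℝ = 0 :=
    Submodule.mem_orthogonal_singleton_iff_inner_right.1 ((koopmanZero κ hκ ^ n) (projQ μ g)).2
  rw [Submodule.coe_inner, projQ_coe f, inner_sub_left, real_inner_smul_left, h0, mul_zero,
    sub_zero, koopmanZero_pow_coe, projQ_coe g, map_sub, map_smul, koopman_pow_oneL2,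
    inner_sub_right, real_inner_smul_right, real_inner_comm (oneL2 μ) f]
  ring

end KoopmanLemmas

/-! ### The cross-covariance operator and the general error formula. -/

section CrossCovariance

variable {X : Type*} [TopologicalSpace X] [SecondCountableTopology X] [MeasurableSpace X]
  [BorelSpace X] {H : Type*} [NormedAddCommGroup H] [InnerProductSpace ℝ H] [CompleteSpace H]
  [RKHS ℝ H X ℝ] {k : X → X → ℝ} (hH : IsRKHSOf H k) (hk : Continuous (Function.uncurry k))
  {μ : Measure X} [IsProbabilityMeasure μ] (hφ : MemLp (fun x ↦ k x x) 2 μ)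
  {κ : Kernel X X} [IsMarkovKernel κ] (hκ : κ.Invariant μ)
  {β : Type*} (b : HilbertBasis β ℝ H)

include hH hk hφ

omit [SecondCountableTopology X] in
theorem memLp_apply (ψ : H) : MemLp (ψ : X → ℝ) 2 μ := by
  have hm : AEStronglyMeasurable (ψ : X → ℝ) μ :=
    (continuous_apply hH hk ψ).aestronglyMeasurable
  rw [memLp_two_iff_integrable_sq hm]
  refine ((hφ.integrable (by norm_num)).const_mul (‖ψ‖ ^ 2)).mono (hm.pow 2) (ae_of_all _ fun x ↦ ?_)
  rw [Real.norm_eq_abs, Real.norm_eq_abs, abs_of_nonneg (sq_nonneg _)]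
  exact (sq_apply_le hH ψ x).trans (le_abs_self _)

include hκ in
theorem memLp_crossLp : MemLp (crossLp b : X × X → lp (fun _ : β ↦ H) 2) 2 (μ ⊗ₘ κ) := by
  have hm : AEStronglyMeasurable (crossLp b : X × X → lp (fun _ : β ↦ H) 2) (μ ⊗ₘ κ) :=
    (continuous_crossLp b hH hk).aestronglyMeasurable
  rw [memLp_two_iff_integrable_sq_norm hm]
  simp only [norm_crossLp_sq b hH]
  exact integrable_mul_compProd hφ hφ hκ

include hκ in
theorem integrable_rankOneOp :
    Integrable (fun z : X × X ↦ rankOneOp H z.1 z.2) (μ ⊗ₘ κ) := by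
  have hm : AEStronglyMeasurable (fun z : X × X ↦ rankOneOp H z.1 z.2) (μ ⊗ₘ κ) :=
    (continuous_rankOneOp hH hk).aestronglyMeasurable
  refine MemLp.integrable (q := 2) (by norm_num) ?_
  rw [memLp_two_iff_integrable_sq_norm hm]
  refine (integrable_mul_compProd hφ hφ hκ).congr (ae_of_all _ fun z ↦ ?_)
  simp only [rankOneOp, InnerProductSpace.norm_rankOne, mul_pow, norm_feature_sq hH]

include hκ in
-- The Bochner integrals in operator norm and in ℓ²(β, H) agree because evaluation at `b i` is
-- continuous and linear on both spaces.
theorem crossCov_apply (i : β) :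
    crossCov H κ μ (b i) = (∫ z, crossLp b z ∂(μ ⊗ₘ κ) : lp (fun _ : β ↦ H) 2) i := by
  have h1 := ContinuousLinearMap.integral_comp_comm (ContinuousLinearMap.apply ℝ H (b i))
    (integrable_rankOneOp hH hk hφ hκ)
  have h2 := ContinuousLinearMap.integral_comp_comm (lp.evalCLM ℝ (fun _ : β ↦ H) 2 i)
    ((memLp_crossLp hH hk hφ hκ b).integrable (by norm_num))
  exact h1.symm.trans h2

/-- 𝔼₀ is the variance of C_{xy} under the pair law: the covariance formula is used with both maps
the identity, and ‖C_{xy}‖² = φ(x)φ(y). -/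
theorem EZero_eq : EZero (H := H) b hφ κ hκ =
    ∫ z, ‖crossLp b z - ∫ w, crossLp b w ∂(μ ⊗ₘ κ)‖ ^ 2 ∂(μ ⊗ₘ κ) := by
  have h := integral_inner_sub_integral (P := μ ⊗ₘ κ) (memLp_crossLp hH hk hφ hκ b)
    (MeasurePreserving.id _) (MeasurePreserving.id _)
  simp only [id, real_inner_self_eq_norm_sq] at h
  rw [h, EZero, hsNormSq_eq_norm_sq b (crossCov_apply hH hk hφ hκ b)]
  congr 1
  simp only [norm_crossLp_sq b hH]
  rw [integral_mul_compProd hκ hφ hφ, real_inner_comm, inner_toLp_left]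

/-- Second moments of the estimator, given the laws of single pairs and of two pairs. -/
theorem estimator_second_moment {Ω : Type*} [MeasurableSpace Ω] {P : Measure Ω}
    [IsProbabilityMeasure P] {m : ℕ} (hm : 1 ≤ m) {x y : ℕ → Ω → X}
    {ν : ℕ → Measure ((X × X) × (X × X))}
    (h1 : ∀ i < m, HasLaw (fun ω ↦ (x i ω, y i ω)) (μ ⊗ₘ κ) P)
    (h2 : ∀ i j, 0 < j → i + j < m →
      HasLaw (fun ω ↦ ((x i ω, y i ω), (x (i + j) ω, y (i + j) ω))) (ν j) P) :
    Integrable (fun ω ↦ hsNormSq b (empCrossCov H m x y ω - crossCov H κ μ)) P ∧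
      (∀ l ∈ Finset.Ico 1 m, Integrable (fun ω ↦
        hsInner b (rankOneOp H (x l ω) (y l ω) - crossCov H κ μ)
          (rankOneOp H (x 0 ω) (y 0 ω) - crossCov H κ μ)) P) ∧
      ∫ ω, hsNormSq b (empCrossCov H m x y ω - crossCov H κ μ) ∂P =
        1 / m * (EZero b hφ κ hκ +
          2 * ∑ l ∈ Finset.Ico 1 m, ((m : ℝ) - l) / m *
            ∫ ω, hsInner b (rankOneOp H (x l ω) (y l ω) - crossCov H κ μ)
              (rankOneOp H (x 0 ω) (y 0 ω) - crossCov H κ μ) ∂P) ∧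
      ∀ l ∈ Finset.Ico 1 m,
        MeasurePreserving Prod.fst (ν l) (μ ⊗ₘ κ) ∧ MeasurePreserving Prod.snd (ν l) (μ ⊗ₘ κ) ∧
        ∫ ω, hsInner b (rankOneOp H (x l ω) (y l ω) - crossCov H κ μ)
          (rankOneOp H (x 0 ω) (y 0 ω) - crossCov H κ μ) ∂P =
        ∫ q, ⟪crossLp b q.2, crossLp b q.1⟫_ℝ ∂(ν l) - ‖∫ z, crossLp b z ∂(μ ⊗ₘ κ)‖ ^ 2 := by
  have hΨ := memLp_crossLp hH hk hφ hκ b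
  have hΨc := continuous_crossLp b hH hk
  set c : lp (fun _ : β ↦ H) 2 := ∫ z, crossLp b z ∂(μ ⊗ₘ κ) with hc
  set Z : ℕ → Ω → lp (fun _ : β ↦ H) 2 := fun l ω ↦ crossLp b (x l ω, y l ω) with hZdef
  have hop : ∀ l ω i, (rankOneOp H (x l ω) (y l ω) - crossCov H κ μ) (b i) = (Z l ω - c) i := by
    intro l ω i
    rw [sub_apply, crossCov_apply hH hk hφ hκ b]
    rfl
  have hinner : ∀ l ω, hsInner b (rankOneOp H (x l ω) (y l ω) - crossCov H κ μ)
      (rankOneOp H (x 0 ω) (y 0 ω) - crossCov H κ μ) = ⟪Z l ω - c, Z 0 ω - c⟫_ℝ :=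
    fun l ω ↦ hsInner_eq_inner b (hop l ω) (hop 0 ω)
  have hnorm : ∀ ω, hsNormSq b (empCrossCov H m x y ω - crossCov H κ μ) =
      ‖(m : ℝ)⁻¹ • ∑ l ∈ Finset.range m, Z l ω - c‖ ^ 2 := by
    intro ω
    refine hsNormSq_eq_norm_sq b fun i ↦ ?_
    rw [sub_apply, crossCov_apply hH hk hφ hκ b, empCrossCov,
      smul_apply, sum_apply, lp.coeFn_sub, Pi.sub_apply,
      lp.coeFn_smul, Pi.smul_apply, lp.coeFn_sum, Finset.sum_apply]
    rfl
  have hmemZ : ∀ l < m, MemLp (Z l) 2 P := by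
    intro l hl
    have h := h1 l hl
    rw [← h.map_eq] at hΨ
    exact hΨ.comp_of_map h.aemeasurable
  have hcov : ∀ i j, 0 < j → i + j < m → ∫ ω, ⟪Z (i + j) ω - c, Z i ω - c⟫_ℝ ∂P =
      ∫ q, ⟪crossLp b q.2 - c, crossLp b q.1 - c⟫_ℝ ∂(ν j) := by
    intro i j hj hij
    have hcont : Continuous fun q : (X × X) × (X × X) ↦
        ⟪crossLp b q.2 - c, crossLp b q.1 - c⟫_ℝ :=
      ((hΨc.comp continuous_snd).sub continuous_const).inner
        ((hΨc.comp continuous_fst).sub continuous_const)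
    rw [← (h2 i j hj hij).map_eq, integral_map (h2 i j hj hij).aemeasurable
      hcont.aestronglyMeasurable]
  -- Lag zero needs only the law of a single pair; positive lags use the law ν j of two pairs.
  have hmain := integral_norm_avg_sub_sq m hm Z c hmemZ (by
    intro i j hij
    rcases Nat.eq_zero_or_pos j with rfl | hj
    · have hcont : Continuous fun q : X × X ↦ ⟪crossLp b q - c, crossLp b q - c⟫_ℝ :=
        (hΨc.sub continuous_const).inner (hΨc.sub continuous_const)
      have h3 : ∀ l < m, ∫ ω, ⟪Z l ω - c, Z l ω - c⟫_ℝ ∂P =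
          ∫ z, ⟪crossLp b z - c, crossLp b z - c⟫_ℝ ∂(μ ⊗ₘ κ) := by
        intro l hl
        rw [← (h1 l hl).map_eq, integral_map (h1 l hl).aemeasurable hcont.aestronglyMeasurable]
      rw [Nat.add_zero, h3 i (by omega), h3 0 (by omega)]
    · rw [hcov i j hj hij, ← hcov 0 j hj (by omega), Nat.zero_add])
  have hE : EZero (H := H) b hφ κ hκ = ∫ ω, ‖Z 0 ω - c‖ ^ 2 ∂P := by
    rw [EZero_eq hH hk hφ hκ b, ← hc, ← (h1 0 (by omega)).map_eq,
      integral_map (h1 0 (by omega)).aemeasurable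
        (by fun_prop : Continuous fun z ↦ ‖crossLp b z - c‖ ^ 2).aestronglyMeasurable]
  simp only [hinner, hnorm, hE]
  refine ⟨hmain.1, fun l hl ↦ ?_, hmain.2, fun l hl ↦ ?_⟩
  · have hl := Finset.mem_Ico.1 hl
    exact integrable_inner_of_memLp ((hmemZ l hl.2).sub (memLp_const c))
      ((hmemZ 0 (by omega)).sub (memLp_const c))
  · have hl := Finset.mem_Ico.1 hl
    have hlaw := h2 0 l (by omega) (by omega)
    have hp : MeasurePreserving Prod.fst (ν l) (μ ⊗ₘ κ) := by
      refine ⟨measurable_fst, ?_⟩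
      rw [← hlaw.map_eq, ← (h1 0 (by omega)).map_eq, AEMeasurable.map_map_of_aemeasurable
        measurable_fst.aemeasurable hlaw.aemeasurable]
      rfl
    have hq : MeasurePreserving Prod.snd (ν l) (μ ⊗ₘ κ) := by
      refine ⟨measurable_snd, ?_⟩
      rw [← hlaw.map_eq, ← (h1 l (by omega)).map_eq, AEMeasurable.map_map_of_aemeasurable
        measurable_snd.aemeasurable hlaw.aemeasurable, Nat.zero_add]
      rfl
    have : IsProbabilityMeasure (ν l) := by
      rw [← hlaw.map_eq]; exact Measure.isProbabilityMeasure_map hlaw.aemeasurable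
    refine ⟨hp, hq, ?_⟩
    have h4 := hcov 0 l (by omega) (by omega)
    rw [Nat.zero_add] at h4
    rw [h4, hc, integral_inner_sub_integral hΨ hq hp]

end CrossCovariance

/-! ### Parseval expansion of the kernel. -/

section KernelExpansion

variable {X H : Type*} [NormedAddCommGroup H] [InnerProductSpace ℝ H] [CompleteSpace H]
  [RKHS ℝ H X ℝ] {k : X → X → ℝ} {ι β : Type*}

theorem hasSum_kernel (hH : IsRKHSOf H k) (F : HilbertBasis ι ℝ H) (x y : X) :
    HasSum (fun j ↦ F j x * F j y) (k x y) := by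
  have h1 := F.hasSum_inner_mul_inner (feature H x) (feature H y)
  rw [inner_feature_feature hH] at h1
  refine h1.congr_fun fun j ↦ ?_
  rw [real_inner_comm, inner_feature, inner_feature]

theorem hasSum_mul_of_real {ι κ : Type*} {f : ι → ℝ} {g : κ → ℝ} {s t : ℝ} (hf : HasSum f s)
    (hg : HasSum g t) : HasSum (fun p : ι × κ ↦ f p.1 * g p.2) (s * t) :=
  hf.mul hg (summable_mul_of_summable_norm hf.summable.norm hg.summable.norm)

/-- The product of two kernel expansions. In p = (i, j), the index i belongs to the second
coordinates y and j to the first coordinates x, matching g_{ij} = f_j · K f_i. -/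
theorem hasSum_inner_crossLp (hH : IsRKHSOf H k) (F : HilbertBasis ι ℝ H)
    (b : HilbertBasis β ℝ H) (z w : X × X) :
    HasSum (fun p : ι × ι ↦ (F p.2 z.1 * F p.1 z.2) * (F p.2 w.1 * F p.1 w.2))
      ⟪crossLp b w, crossLp b z⟫_ℝ := by
  have h2 := hasSum_mul_of_real (hasSum_kernel hH F z.2 w.2) (hasSum_kernel hH F z.1 w.1)
  have h3 : ⟪crossLp b w, crossLp b z⟫_ℝ = k z.2 w.2 * k z.1 w.1 := by
    rw [real_inner_comm, inner_crossLp b hH, mul_comm]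
  rw [h3]
  convert h2 using 2 with p
  generalize (F p.2 : H) = u
  generalize (F p.1 : H) = v
  ring
end KernelExpansion

/-! ### Mercer bases and termwise integration. -/

section Mercer

variable {X : Type*} [TopologicalSpace X] [SecondCountableTopology X] [MeasurableSpace X]
  [BorelSpace X] {H : Type*} [NormedAddCommGroup H] [InnerProductSpace ℝ H] [CompleteSpace H]
  [RKHS ℝ H X ℝ] {k : X → X → ℝ} (hH : IsRKHSOf H k) (hk : Continuous (Function.uncurry k))
  {μ : Measure X} [IsProbabilityMeasure μ]

include hH hk

theorem integrable_smul_feature (hφ : MemLp (fun x ↦ k x x) 2 μ) (ψ : Lp ℝ 2 μ) :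
    Integrable (fun x ↦ ψ x • feature H x) μ := by
  have hm : AEStronglyMeasurable (feature H : X → H) μ :=
    (continuous_feature hH hk).aestronglyMeasurable
  have h1 : MemLp (feature H : X → H) 2 μ := by
    rw [memLp_two_iff_integrable_sq_norm hm]
    simp only [norm_feature_sq hH]
    exact hφ.integrable (by norm_num)
  exact memLp_one_iff_integrable.1 (h1.smul (Lp.memLp ψ))

theorem inner_embedOp (hφ : MemLp (fun x ↦ k x x) 2 μ) (h : H) (ψ : Lp ℝ 2 μ) :
    ⟪h, embedOp H ψ⟫_ℝ = ∫ x, ψ x * h x ∂μ := by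
  rw [embedOp, ← integral_inner (integrable_smul_feature hH hk hφ ψ)]
  simp only [real_inner_smul_right, inner_feature]

/-- A Mercer basis induces a Hilbert basis of the reproducing kernel Hilbert space whose elements
represent the functions `√λ_j e_j`. -/
theorem IsMercerBasis.exists_hilbertBasis (hcomp : Compatible H k μ) {ι : Type*}
    {e : HilbertBasis ι ℝ (Lp ℝ 2 μ)} {lam : ι → ℝ} (he : IsMercerBasis H e lam) :
    ∃ F : HilbertBasis ι ℝ H, ∀ j, mercerFun e lam j =
      (memLp_apply hH hk hcomp.memLp_diag (F j)).toLp (F j) := by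
  have hφ := hcomp.memLp_diag
  set v : ι → H := fun j ↦ (√(lam j))⁻¹ • embedOp H (e j) with hv
  have hs : ∀ j, √(lam j) ≠ 0 := fun j ↦ (Real.sqrt_pos.2 (he.pos j)).ne'
  have hvae : ∀ j, ∀ᵐ x ∂μ, v j x = √(lam j) * e j x := by
    intro j
    filter_upwards [he.eigen j] with x hx
    rw [hv]
    simp only [RKHS.coe_smul, Pi.smul_apply, smul_eq_mul, hx]
    rw [← mul_assoc]
    congr 1
    have := Real.mul_self_sqrt (he.pos j).le
    field_simp [hs j]
    linarith
  have hinner : ∀ (h : H) j, ⟪h, v j⟫_ℝ = (√(lam j))⁻¹ * ∫ x, e j x * h x ∂μ := by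
    intro h j
    rw [hv]
    simp only
    rw [real_inner_smul_right, inner_embedOp hH hk hφ]
  -- The reproducing property turns one factor into an L² pairing with e_j; the eigenvalue equation
  -- replaces the other by √λ_i e_i.
  have hinner2 : ∀ i j, ⟪v i, v j⟫_ℝ = (√(lam j))⁻¹ * √(lam i) * ⟪e i, e j⟫_ℝ := by
    intro i j
    rw [hinner, mul_assoc, inner_eq_integral_mul, ← integral_const_mul (√(lam i))]
    congr 1
    refine integral_congr_ae ?_
    filter_upwards [hvae i] with x hx
    rw [hx]
    ring
  have hortho : Orthonormal ℝ v := by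
    constructor
    · intro i
      have h1 : ⟪v i, v i⟫_ℝ = 1 := by
        rw [hinner2, real_inner_self_eq_norm_sq, e.orthonormal.1 i, inv_mul_cancel₀ (hs i)]
        norm_num
      rw [real_inner_self_eq_norm_sq] at h1
      nlinarith [norm_nonneg (v i)]
    · intro i j hij
      rw [hinner2, e.orthonormal.2 hij, mul_zero]
  -- If h is orthogonal to every v_j, its class in L² is orthogonal to every e_j, so h = 0 a.e. and,
  -- by compatibility, everywhere.
  have hbot : (Submodule.span ℝ (Set.range v))ᗮ = ⊥ := by
    rw [Submodule.eq_bot_iff]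
    intro h hh
    have hm := memLp_apply hH hk hφ h
    have h0 : hm.toLp h = 0 := by
      have h1 : ∀ j, ⟪e j, hm.toLp h⟫_ℝ = 0 := by
        intro j
        have h2 : ⟪h, v j⟫_ℝ = 0 := by
          rw [real_inner_comm]
          exact hh _ (Submodule.subset_span ⟨j, rfl⟩)
        rw [hinner, mul_eq_zero_iff_left (inv_ne_zero (hs j))] at h2
        rw [real_inner_comm, inner_toLp_left, ← h2]
        exact integral_congr_ae (ae_of_all _ fun x ↦ mul_comm _ _)
      have h3 := e.hasSum_inner_mul_inner (hm.toLp h) (hm.toLp h)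
      simp only [h1, mul_zero] at h3
      exact inner_self_eq_zero.1 (h3.unique hasSum_zero)
    have hae : ∀ᵐ x ∂μ, h x = 0 := by
      have h1 := hm.coeFn_toLp
      rw [h0] at h1
      filter_upwards [h1, Lp.coeFn_zero ℝ 2 μ] with x h2 h3
      rw [← h2, h3]
      rfl
    exact RKHS.ext fun x ↦ by rw [hcomp.eq_zero_of_ae h hae x]; simp
  refine ⟨HilbertBasis.mkOfOrthogonalEqBot hortho hbot, fun j ↦ ?_⟩
  refine Lp.ext ?_
  rw [HilbertBasis.coe_mkOfOrthogonalEqBot]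
  filter_upwards [hvae j, Lp.coeFn_smul (√(lam j)) (e j),
    (memLp_apply hH hk hφ (v j)).coeFn_toLp] with x h1 h2 h3
  rw [h3, h1, mercerFun, h2]
  rfl

variable {ι : Type*} (F : HilbertBasis ι ℝ H) {β : Type*} (b : HilbertBasis β ℝ H)

omit [SecondCountableTopology X] in
theorem memLp_mul_apply (hφ : MemLp (fun x ↦ k x x) 2 μ) {κ : Kernel X X} [IsMarkovKernel κ]
    (hκ : κ.Invariant μ) (f g : H) : MemLp (fun z : X × X ↦ f z.1 * g z.2) 2 (μ ⊗ₘ κ) := by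
  have hf := (continuous_apply hH hk f).measurable
  have hg := (continuous_apply hH hk g).measurable
  have hm : AEStronglyMeasurable (fun z : X × X ↦ f z.1 * g z.2) (μ ⊗ₘ κ) :=
    ((hf.comp measurable_fst).mul (hg.comp measurable_snd)).aestronglyMeasurable
  rw [memLp_two_iff_integrable_sq hm]
  refine ((integrable_mul_compProd hφ hφ hκ).const_mul (‖f‖ ^ 2 * ‖g‖ ^ 2)).mono (hm.pow 2)
    (ae_of_all _ fun z ↦ ?_)
  rw [Real.norm_eq_abs, Real.norm_eq_abs, abs_of_nonneg (sq_nonneg _), mul_pow]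
  refine le_trans ?_ (le_abs_self _)
  calc f z.1 ^ 2 * g z.2 ^ 2 ≤ (‖f‖ ^ 2 * k z.1 z.1) * (‖g‖ ^ 2 * k z.2 z.2) :=
        mul_le_mul (sq_apply_le hH f _) (sq_apply_le hH g _) (sq_nonneg _)
          (mul_nonneg (sq_nonneg _) (diag_nonneg hH _))
    _ = _ := by ring

/-- Expansion of the mixed second moment of `C_{xy}` in a basis, for a coupling of two pairs. -/
theorem hasSum_integral_coupling [Countable ι] (hφ : MemLp (fun x ↦ k x x) 2 μ)
    {κ : Kernel X X} [IsMarkovKernel κ] (hκ : κ.Invariant μ)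
    {ν : Measure ((X × X) × (X × X))} (h1 : MeasurePreserving Prod.fst ν (μ ⊗ₘ κ))
    (h2 : MeasurePreserving Prod.snd ν (μ ⊗ₘ κ)) :
    HasSum (fun p : ι × ι ↦
        ∫ q, (F p.2 q.1.1 * F p.1 q.1.2) * (F p.2 q.2.1 * F p.1 q.2.2) ∂ν)
      (∫ q, ⟪crossLp b q.2, crossLp b q.1⟫_ℝ ∂ν) := by
  have hΨ := memLp_crossLp hH hk hφ hκ b
  set a : ι × ι → X × X → ℝ := fun p z ↦ F p.2 z.1 * F p.1 z.2 with ha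
  have hm : ∀ p, MemLp (a p) 2 (μ ⊗ₘ κ) := fun p ↦ memLp_mul_apply hH hk hφ hκ _ _
  have hm1 : ∀ p, MemLp (fun q : (X × X) × (X × X) ↦ a p q.1) 2 ν :=
    fun p ↦ (hm p).comp_measurePreserving h1
  have hm2 : ∀ p, MemLp (fun q : (X × X) × (X × X) ↦ a p q.2) 2 ν :=
    fun p ↦ (hm p).comp_measurePreserving h2
  have hInt : ∀ p, Integrable (fun q : (X × X) × (X × X) ↦ a p q.1 * a p q.2) ν :=
    fun p ↦ (hm1 p).integrable_mul (hm2 p)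
  have hb1 : Integrable (fun q : (X × X) × (X × X) ↦ ‖crossLp b q.1‖ ^ 2) ν :=
    (hΨ.comp_measurePreserving h1).integrable_norm_pow (by norm_num)
  have hb2 : Integrable (fun q : (X × X) × (X × X) ↦ ‖crossLp b q.2‖ ^ 2) ν :=
    (hΨ.comp_measurePreserving h2).integrable_norm_pow (by norm_num)
  have hle : ∀ (u : Finset (ι × ι)) (z : X × X), ∑ p ∈ u, a p z * a p z ≤ ‖crossLp b z‖ ^ 2 := by
    intro u z
    rw [← real_inner_self_eq_norm_sq]
    exact sum_le_hasSum u (fun p _ ↦ mul_self_nonneg _) (hasSum_inner_crossLp hH F b z z)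
  -- With |ab| ≤ a² + b², the finite sums are dominated by ‖C‖² at the two pairs, which is
  -- integrable since both marginals of ν are the pair law. This permits exchanging sum and
  -- integral.
  have hsum : Summable fun p ↦ ∫ q, ‖a p q.1 * a p q.2‖ ∂ν := by
    refine summable_of_sum_le (c := ∫ q, ‖crossLp b q.1‖ ^ 2 + ‖crossLp b q.2‖ ^ 2 ∂ν)
      (fun p ↦ integral_nonneg fun q ↦ norm_nonneg _) fun u ↦ ?_
    rw [← integral_finsetSum _ fun p _ ↦ (hInt p).norm]
    refine integral_mono (integrable_finsetSum _ fun p _ ↦ (hInt p).norm) (hb1.add hb2)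
      fun q ↦ ?_
    calc ∑ p ∈ u, ‖a p q.1 * a p q.2‖
        ≤ ∑ p ∈ u, (a p q.1 * a p q.1 + a p q.2 * a p q.2) := by
          refine Finset.sum_le_sum fun p _ ↦ ?_
          rw [Real.norm_eq_abs, abs_le]
          constructor <;> nlinarith [sq_nonneg (a p q.1 + a p q.2), sq_nonneg (a p q.1 - a p q.2),
            mul_self_nonneg (a p q.1), mul_self_nonneg (a p q.2)]
      _ ≤ _ := by
          rw [Finset.sum_add_distrib]
          exact add_le_add (hle u q.1) (hle u q.2)
  have h := hasSum_integral_of_summable_integral_norm hInt hsum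
  have heq : ∀ q : (X × X) × (X × X), ∑' p, a p q.1 * a p q.2 = ⟪crossLp b q.2, crossLp b q.1⟫_ℝ :=
    fun q ↦ (hasSum_inner_crossLp hH F b q.1 q.2).tsum_eq
  simp only [heq] at h
  exact h

end Mercer

/-! ### Mixed moments of the stationary chain. -/

section CrossMoments

variable {X : Type*} [MeasurableSpace X] {μ : Measure X} [IsProbabilityMeasure μ]
  {κ : Kernel X X} [IsMarkovKernel κ] (hκ : κ.Invariant μ)

omit [IsProbabilityMeasure μ] in
theorem integrable_integral_compProd [SFinite μ] {Y : Type*} [MeasurableSpace Y] {κ : Kernel X Y}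
    [IsSFiniteKernel κ] {f : X × Y → ℝ} (hf : Integrable f (μ ⊗ₘ κ)) :
    Integrable (fun x ↦ ∫ y, f (x, y) ∂(κ x)) μ := by
  rw [Measure.compProd] at hf
  simpa using hf.integral_compProd

/-- `∫∫ f(x) g(y) V(y) κ(x, dy) dμ(x) = ∫ g · K* f · V dμ`, whenever both sides converge. -/
theorem integral_mul_mul_compProd {f g V : X → ℝ} (hf : MemLp f 2 μ) (hg : Measurable g)
    (hV : MemLp V 2 μ) (hi1 : Integrable (fun z : X × X ↦ f z.1 * g z.2 * V z.2) (μ ⊗ₘ κ))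
    (hi2 : Integrable (fun x ↦
      g x * ContinuousLinearMap.adjoint (koopman κ hκ) (hf.toLp f) x * V x) μ) :
    ∫ z, f z.1 * g z.2 * V z.2 ∂(μ ⊗ₘ κ) =
      ∫ x, g x * ContinuousLinearMap.adjoint (koopman κ hκ) (hf.toLp f) x * V x ∂μ := by
  -- The product g·V need not lie in L², so duality is applied to its truncation to |g| ≤ n; the
  -- given integrability of both sides allows n → ∞.
  set B : ℕ → Set X := fun n ↦ {x | |g x| ≤ n} with hB
  have hBm : ∀ n, MeasurableSet (B n) := fun n ↦ measurableSet_le hg.abs measurable_const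
  have hmono : Monotone B := fun n n' h x (hx : |g x| ≤ n) ↦
    hx.trans (by exact_mod_cast h : (n : ℝ) ≤ n')
  have hU : ⋃ n, B n = Set.univ :=
    Set.eq_univ_of_forall fun x ↦ Set.mem_iUnion.2 (exists_nat_ge |g x|)
  have hU' : ⋃ n, (Prod.snd ⁻¹' B n : Set (X × X)) = Set.univ := by
    rw [← Set.preimage_iUnion, hU, Set.preimage_univ]
  have t1 := tendsto_setIntegral_of_monotone (μ := μ ⊗ₘ κ)
    (s := fun n ↦ (Prod.snd ⁻¹' B n : Set (X × X)))
    (fun n ↦ measurable_snd (hBm n)) (fun n n' h ↦ Set.preimage_mono (hmono h))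
    (hi1.integrableOn)
  have t2 := tendsto_setIntegral_of_monotone hBm hmono (hi2.integrableOn)
  rw [hU', Measure.restrict_univ] at t1
  rw [hU, Measure.restrict_univ] at t2
  refine tendsto_nhds_unique t1 (t2.congr fun n ↦ ?_)
  have hW : MemLp ((B n).indicator fun x ↦ g x * V x) 2 μ := by
    refine MemLp.of_le_mul (c := n) hV
      ((hg.aestronglyMeasurable.mul hV.aestronglyMeasurable).indicator (hBm n))
      (ae_of_all _ fun x ↦ ?_)
    by_cases hx : x ∈ B n
    · rw [Set.indicator_of_mem hx, norm_mul]
      exact mul_le_mul_of_nonneg_right hx (norm_nonneg _)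
    · rw [Set.indicator_of_notMem hx, norm_zero]
      positivity
  have e1 : ∫ z in Prod.snd ⁻¹' B n, f z.1 * g z.2 * V z.2 ∂(μ ⊗ₘ κ) =
      ∫ z, f z.1 * (B n).indicator (fun x ↦ g x * V x) z.2 ∂(μ ⊗ₘ κ) := by
    rw [← integral_indicator (measurable_snd (hBm n))]
    refine integral_congr_ae (ae_of_all _ fun z ↦ ?_)
    by_cases hz : z.2 ∈ B n
    · simp [hz, mul_assoc]
    · simp [hz]
  rw [e1, integral_mul_compProd hκ hf hW, ← inner_toLp_left hf,
    ← ContinuousLinearMap.adjoint_inner_left, real_inner_comm, inner_toLp_left,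
    ← integral_indicator (hBm n)]
  refine integral_congr_ae (ae_of_all _ fun x ↦ ?_)
  by_cases hx : x ∈ B n
  · simp [hx]; ring
  · simp [hx]

/-- The mixed moment of a function `f(x) g(y)` of two pairs of the stationary chain. -/
theorem integral_chainLaw {ρ : TransitionSemigroup X} (hμ : IsInvariant ρ μ) (t u : ℝ≥0)
    {f g : X → ℝ} (hgm : Measurable g) (hf : MemLp f 2 μ) (hg : MemLp g 2 μ)
    (hfg : MemLp (fun z : X × X ↦ f z.1 * g z.2) 2 (μ ⊗ₘ ρ.ker t))
    (h1 : MeasurePreserving Prod.fst (chainLaw ρ t u μ) (μ ⊗ₘ ρ.ker t))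
    (h2 : MeasurePreserving Prod.snd (chainLaw ρ t u μ) (μ ⊗ₘ ρ.ker t))
    {G G' : Lp ℝ 2 μ} (hG : ∀ᵐ x ∂μ, G x = f x * koopman (ρ.ker t) (hμ t) (hg.toLp g) x)
    (hG' : ∀ᵐ x ∂μ,
      G' x = g x * ContinuousLinearMap.adjoint (koopman (ρ.ker t) (hμ t)) (hf.toLp f) x) :
    ∫ q, (f q.1.1 * g q.1.2) * (f q.2.1 * g q.2.2) ∂(chainLaw ρ t u μ) =
      ⟪G', koopman (ρ.ker u) (hμ u) G⟫_ℝ := by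
  have hInt : Integrable (fun q : (X × X) × (X × X) ↦ (f q.1.1 * g q.1.2) * (f q.2.1 * g q.2.2))
      (chainLaw ρ t u μ) :=
    (hfg.comp_measurePreserving h1).integrable_mul (hfg.comp_measurePreserving h2)
  rw [chainLaw] at hInt ⊢
  rw [integral_map_equiv]
  have hInt1 := (integrable_map_equiv _ _).1 hInt
  simp only [Function.comp_def] at hInt1
  rw [Measure.integral_compProd hInt1]
  have hInt2 := integrable_integral_compProd hInt1
  -- Integrating out the last time gives the Koopman image of g at the third, so the second pair
  -- contributes G there.
  have e1 : ∀ w : (X × X) × X, ∫ y, (f (MeasurableEquiv.prodAssoc (w, y)).1.1 *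
        g (MeasurableEquiv.prodAssoc (w, y)).1.2) * (f (MeasurableEquiv.prodAssoc (w, y)).2.1 *
        g (MeasurableEquiv.prodAssoc (w, y)).2.2)
        ∂(ρ.ker t w.2) =
      (f w.1.1 * g w.1.2) * (f w.2 * ∫ y, g y ∂(ρ.ker t w.2)) := by
    intro w
    rw [← integral_const_mul, ← integral_const_mul]
    rfl
  simp only [Kernel.comap_apply, e1] at hInt2 ⊢
  rw [Measure.integral_compProd hInt2]
  have hG2 : ∀ᵐ x ∂μ, G x = f x * ∫ y, g y ∂(ρ.ker t x) := by
    filter_upwards [hG, koopman_toLp (hμ t) hg] with x h3 h4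
    rw [h3, h4]
  have e2 : ∀ᵐ x ∂μ, ∫ y, f y * ∫ w, g w ∂(ρ.ker t y) ∂(ρ.ker u x) =
      koopman (ρ.ker u) (hμ u) G x := by
    filter_upwards [koopman_ae_eq (ρ.ker u) (hμ u) G, ae_ae_of_ae (hμ u) hG2] with x h3 h4
    rw [h3, integral_congr_ae h4]
  have e3 : ∫ z : X × X, ∫ y, (f z.1 * g z.2) * (f y * ∫ w, g w ∂(ρ.ker t y))
      ∂(ρ.ker u z.2) ∂(μ ⊗ₘ ρ.ker t) =
      ∫ z, f z.1 * g z.2 * koopman (ρ.ker u) (hμ u) G z.2 ∂(μ ⊗ₘ ρ.ker t) := by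
    refine integral_congr_ae ?_
    -- The μ-a.e. identity holds along the second coordinate of the pair because that coordinate has
    -- law μ.
    filter_upwards [(measurePreserving_snd_compProd (hμ t)).quasiMeasurePreserving.ae e2] with z hz
    rw [integral_const_mul, hz]
  refine e3.trans ?_
  have hi1 : Integrable (fun z : X × X ↦ f z.1 * g z.2 * koopman (ρ.ker u) (hμ u) G z.2)
      (μ ⊗ₘ ρ.ker t) := hfg.integrable_mul (memLp_comp_snd (hμ t) (Lp.memLp _))
  have e4 : ∀ᵐ x ∂μ, G' x * koopman (ρ.ker u) (hμ u) G x =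
      g x * ContinuousLinearMap.adjoint (koopman (ρ.ker t) (hμ t)) (hf.toLp f) x *
        koopman (ρ.ker u) (hμ u) G x := by
    filter_upwards [hG'] with x hx
    rw [hx]
  rw [integral_mul_mul_compProd (hμ t) hf hgm (Lp.memLp _) hi1
    ((integrable_mul_Lp G' _).congr e4), inner_eq_integral_mul]
  exact (integral_congr_ae e4).symm

/-- With the adjoint version below: g_{ij} and g*_{ji} have the same mean, so the product of their
means is the (i, j) term of ‖C‖². -/
theorem inner_oneL2_eq_integral {f g : X → ℝ} (hf : MemLp f 2 μ) (hg : MemLp g 2 μ)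
    {G : Lp ℝ 2 μ} (hG : ∀ᵐ x ∂μ, G x = f x * koopman κ hκ (hg.toLp g) x) :
    ⟪oneL2 μ, G⟫_ℝ = ∫ z, f z.1 * g z.2 ∂(μ ⊗ₘ κ) := by
  rw [inner_oneL2, integral_mul_compProd hκ hf hg, integral_congr_ae hG]

theorem inner_oneL2_eq_integral_adjoint {f g : X → ℝ} (hf : MemLp f 2 μ) (hg : MemLp g 2 μ)
    {G : Lp ℝ 2 μ}
    (hG : ∀ᵐ x ∂μ, G x = g x * ContinuousLinearMap.adjoint (koopman κ hκ) (hf.toLp f) x) :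
    ⟪oneL2 μ, G⟫_ℝ = ∫ z, f z.1 * g z.2 ∂(μ ⊗ₘ κ) := by
  rw [inner_oneL2, integral_mul_compProd hκ hf hg, integral_congr_ae hG, ← inner_toLp_left hg,
    ContinuousLinearMap.adjoint_inner_right, ← inner_toLp_left hf, real_inner_comm]

end CrossMoments

/-! ### The covariance series for sliding-window data. -/

section SlidingWindow

variable {X : Type*} [TopologicalSpace X] [SecondCountableTopology X] [MeasurableSpace X]
  [BorelSpace X] {H : Type*} [NormedAddCommGroup H] [InnerProductSpace ℝ H] [CompleteSpace H]
  [RKHS ℝ H X ℝ] {k : X → X → ℝ} (hH : IsRKHSOf H k) (hk : Continuous (Function.uncurry k))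
  {μ : Measure X} [IsProbabilityMeasure μ] (hφ : MemLp (fun x ↦ k x x) 2 μ)
  {ι : Type*} (F : HilbertBasis ι ℝ H) {f : ι → Lp ℝ 2 μ}
  (hf : ∀ j, f j = (memLp_apply hH hk hφ (F j)).toLp (F j))

omit [SecondCountableTopology X] in
include hf in
theorem sq_le_diag_ae (j : ι) :
    ∀ᵐ x ∂μ, f j x ^ 2 ≤ ((hφ.const_mul (‖F j‖ ^ 2)).toLp _ : Lp ℝ 2 μ) x := by
  filter_upwards [(hφ.const_mul (‖F j‖ ^ 2)).coeFn_toLp,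
    (memLp_apply hH hk hφ (F j)).coeFn_toLp] with x h1 h2
  rw [h1, hf j, h2]
  exact sq_apply_le hH _ _

omit [SecondCountableTopology X] in
include hf in
theorem memLp_gFun {κ : Kernel X X} [IsMarkovKernel κ] (hκ : κ.Invariant μ) (i j : ι) :
    MemLp (gFun κ hκ f i j) 2 μ :=
  memLp_mul_of_positive (koopman κ hκ) (fun _ ↦ koopman_nonneg hκ) (koopman_oneL2 hκ)
    (sq_le_diag_ae hH hk hφ F hf j) (sq_le_diag_ae hH hk hφ F hf i)

omit [SecondCountableTopology X] in
include hf in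
theorem memLp_gStarFun {κ : Kernel X X} [IsMarkovKernel κ] (hκ : κ.Invariant μ) (j i : ι) :
    MemLp (gStarFun κ hκ f j i) 2 μ :=
  memLp_mul_of_positive (ContinuousLinearMap.adjoint (koopman κ hκ))
    (fun _ ↦ adjoint_koopman_nonneg hκ) (adjoint_koopman_oneL2 hκ)
    (sq_le_diag_ae hH hk hφ F hf i) (sq_le_diag_ae hH hk hφ F hf j)

include hH hk hφ hf in
/-- The lagged covariance of the stationary chain, expanded in a basis. -/
theorem hasSum_covariance [Countable ι] {β : Type*} (b : HilbertBasis β ℝ H)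
    {ρ : TransitionSemigroup X} (hμ : IsInvariant ρ μ) (t : ℝ≥0) (n : ℕ)
    (h1 : MeasurePreserving Prod.fst (chainLaw ρ t (n * t) μ) (μ ⊗ₘ ρ.ker t))
    (h2 : MeasurePreserving Prod.snd (chainLaw ρ t (n * t) μ) (μ ⊗ₘ ρ.ker t))
    (hg : ∀ i j, MemLp (gFun (ρ.ker t) (hμ t) f i j) 2 μ)
    (hg' : ∀ j i, MemLp (gStarFun (ρ.ker t) (hμ t) f j i) 2 μ) :
    HasSum (fun p : ι × ι ↦ ⟪projQ μ ((hg' p.2 p.1).toLp _),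
        (koopmanZero (ρ.ker t) (hμ t) ^ n) (projQ μ ((hg p.1 p.2).toLp _))⟫_ℝ)
      (∫ q, ⟪crossLp b q.2, crossLp b q.1⟫_ℝ ∂(chainLaw ρ t (n * t) μ) -
        ‖∫ z, crossLp b z ∂(μ ⊗ₘ ρ.ker t)‖ ^ 2) := by
  have hm := fun j ↦ memLp_apply hH hk hφ (F j)
  have s1 := hasSum_integral_coupling hH hk F b hφ (hμ t) h1 h2
  -- The same expansion for two independent pairs produces ‖C‖², so the difference can be taken term
  -- by term.
  have s2 := hasSum_integral_coupling hH hk F b hφ (hμ t)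
    (ν := (μ ⊗ₘ ρ.ker t).prod (μ ⊗ₘ ρ.ker t)) measurePreserving_fst measurePreserving_snd
  rw [integral_inner_prod (memLp_crossLp hH hk hφ (hμ t) b)] at s2
  refine (s1.sub s2).congr_fun fun p ↦ ?_
  have hG : ∀ᵐ x ∂μ, (hg p.1 p.2).toLp _ x =
      F p.2 x * koopman (ρ.ker t) (hμ t) ((hm p.1).toLp (F p.1)) x := by
    filter_upwards [(hg p.1 p.2).coeFn_toLp, (hm p.2).coeFn_toLp] with x h3 h4
    rw [h3, gFun, hf p.1, hf p.2, h4]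
  have hG' : ∀ᵐ x ∂μ, (hg' p.2 p.1).toLp _ x = F p.1 x *
      ContinuousLinearMap.adjoint (koopman (ρ.ker t) (hμ t)) ((hm p.2).toLp (F p.2)) x := by
    filter_upwards [(hg' p.2 p.1).coeFn_toLp, (hm p.1).coeFn_toLp] with x h3 h4
    rw [h3, gStarFun, hf p.1, hf p.2, h4]
  rw [inner_projQ_pow, ← koopman_nat_mul hμ,
    integral_chainLaw hμ t (n * t) (continuous_apply hH hk (F p.1)).measurable (hm p.2) (hm p.1)
      (memLp_mul_apply hH hk hφ (hμ t) _ _) h1 h2 hG hG',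
    inner_oneL2_eq_integral (hμ t) (hm p.2) (hm p.1) hG,
    inner_oneL2_eq_integral_adjoint (hμ t) (hm p.2) (hm p.1) hG']
  congr 1
  exact (integral_prod_mul (fun z : X × X ↦ F p.2 z.1 * F p.1 z.2)
    (fun z : X × X ↦ F p.2 z.1 * F p.1 z.2)).symm

theorem inner_aeval_Fpoly {E : Type*} [NormedAddCommGroup E] [InnerProductSpace ℝ E]
    (T : E →L[ℝ] E) (m : ℕ) (u v : E) :
    ⟪u, aeval T (Fpoly m) v⟫_ℝ =
      2 * ∑ l ∈ Finset.Ico 1 m, ((m : ℝ) - l) / m * ⟪u, (T ^ (l - 1)) v⟫_ℝ := by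
  rw [Fpoly, map_mul, map_sum, aeval_C, Algebra.algebraMap_eq_smul_one, smul_mul_assoc, one_mul,
    smul_apply, real_inner_smul_right, sum_apply, inner_sum]
  congr 1
  refine Finset.sum_congr rfl fun l _ ↦ ?_
  rw [map_mul, map_pow, aeval_X, aeval_C, Algebra.algebraMap_eq_smul_one, smul_mul_assoc, one_mul,
    smul_apply, real_inner_smul_right]

end SlidingWindow

end KoopmanRKHS

/-! ### The theorem. -/

theorem theorem3p1
    {d : ℕ} {X : Set (EuclideanSpace ℝ (Fin d))}
    (ρ : TransitionSemigroup X) (μ : Measure X) [IsProbabilityMeasure μ] (hμ : IsInvariant ρ μ)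
    (k : X → X → ℝ) (hk_cont : Continuous (Function.uncurry k))
    (hk_symm : ∀ x y, k x y = k y x)
    (hk_psd : ∀ (n : ℕ) (x : Fin n → X) (c : Fin n → ℝ),
      0 ≤ ∑ i, ∑ j, k (x i) (x j) * c i * c j)
    {H : Type*} [NormedAddCommGroup H] [InnerProductSpace ℝ H] [CompleteSpace H] [RKHS ℝ H X ℝ]
    (hH : IsRKHSOf H k) (hcomp : Compatible H k μ)
    {β : Type*} (b : HilbertBasis β ℝ H)
    (t : ℝ≥0) (ht : 0 < t) (m : ℕ) (hm : 1 ≤ m)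
    {Ω : Type*} [MeasurableSpace Ω] (P : Measure Ω) [IsProbabilityMeasure P]
    (x y : ℕ → Ω → X) :
    Integrable (fun z : X × X ↦ rankOneOp H z.1 z.2) (μ ⊗ₘ ρ.ker t) ∧
    IsHilbertSchmidt b (crossCov H (ρ.ker t) μ) ∧
    ((IIDSampling (ρ.ker t) μ P m x y ∨ SlidingWindowSampling ρ t μ P m x y) →
      Integrable (fun ω ↦ hsNormSq b (empCrossCov H m x y ω - crossCov H (ρ.ker t) μ)) P ∧
      (∀ l ∈ Finset.Ico 1 m, Integrable (fun ω ↦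
        hsInner b (rankOneOp H (x l ω) (y l ω) - crossCov H (ρ.ker t) μ)
          (rankOneOp H (x 0 ω) (y 0 ω) - crossCov H (ρ.ker t) μ)) P) ∧
      ∫ ω, hsNormSq b (empCrossCov H m x y ω - crossCov H (ρ.ker t) μ) ∂P =
        1 / m * (EZero b hcomp.memLp_diag (ρ.ker t) (hμ t) +
          2 * ∑ l ∈ Finset.Ico 1 m, ((m : ℝ) - l) / m *
            ∫ ω, hsInner b (rankOneOp H (x l ω) (y l ω) - crossCov H (ρ.ker t) μ)
              (rankOneOp H (x 0 ω) (y 0 ω) - crossCov H (ρ.ker t) μ) ∂P)) ∧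
    (IIDSampling (ρ.ker t) μ P m x y →
      ∫ ω, hsNormSq b (empCrossCov H m x y ω - crossCov H (ρ.ker t) μ) ∂P =
        1 / m * EZero b hcomp.memLp_diag (ρ.ker t) (hμ t)) ∧
    (SlidingWindowSampling ρ t μ P m x y → IsErgodic ρ μ →
      (1 : ℝ) ∈ resolventSet ℝ (koopmanZero (ρ.ker t) (hμ t)) →
      aeval (koopmanZero (ρ.ker t) (hμ t)) (Fpoly m) =
        (2 : ℝ) • (Ring.inverse (1 - koopmanZero (ρ.ker t) (hμ t)) *
          (1 - (m : ℝ)⁻¹ • (Ring.inverse (1 - koopmanZero (ρ.ker t) (hμ t)) *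
            (1 - koopmanZero (ρ.ker t) (hμ t) ^ m)))) ∧
      ∀ {ι : Type*} (e : HilbertBasis ι ℝ (Lp ℝ 2 μ)) (lam : ι → ℝ), IsMercerBasis H e lam →
        ∃ (hg : ∀ i j, MemLp (gFun (ρ.ker t) (hμ t) (mercerFun e lam) i j) 2 μ)
          (hg' : ∀ j i, MemLp (gStarFun (ρ.ker t) (hμ t) (mercerFun e lam) j i) 2 μ),
          Summable (fun p : ι × ι ↦
            ⟪projQ μ ((hg' p.2 p.1).toLp _),
              aeval (koopmanZero (ρ.ker t) (hμ t)) (Fpoly m)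
                (projQ μ ((hg p.1 p.2).toLp _))⟫_ℝ) ∧
          ∫ ω, hsNormSq b (empCrossCov H m x y ω - crossCov H (ρ.ker t) μ) ∂P =
            1 / m * (EZero b hcomp.memLp_diag (ρ.ker t) (hμ t) +
              ∑' p : ι × ι,
                ⟪projQ μ ((hg' p.2 p.1).toLp _),
                  aeval (koopmanZero (ρ.ker t) (hμ t)) (Fpoly m)
                    (projQ μ ((hg p.1 p.2).toLp _))⟫_ℝ)) ∧
    (∀ z : ℂ, z ≠ 1 →
      aeval z (Fpoly m) = 2 / (1 - z) * (1 - (1 - z ^ m) / (m * (1 - z)))) := by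
  have hφ := hcomp.memLp_diag
  have hiid : IIDSampling (ρ.ker t) μ P m x y → _ := fun h ↦
    estimator_second_moment hH hk_cont hφ (hμ t) b hm (fun i hi ↦ h.hasLaw_pair hi)
      (fun i j hj hij ↦ h.hasLaw_two_pairs hj hij)
  have hsw : SlidingWindowSampling ρ t μ P m x y → _ := fun h ↦
    estimator_second_moment hH hk_cont hφ (hμ t) b hm (fun i hi ↦ h.hasLaw_pair hμ hi)
      (ν := fun j ↦ chainLaw ρ t ((j - 1 : ℕ) * t) μ)
      (fun i j hj hij ↦ h.hasLaw_two_pairs hμ hj hij)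
  refine ⟨integrable_rankOneOp hH hk_cont hφ (hμ t),
    isHilbertSchmidt_of_lp b (crossCov_apply hH hk_cont hφ (hμ t) b), ?_, ?_, ?_,
    fun z hz ↦ aeval_Fpoly_complex m hm z hz⟩
  · rintro (h | h)
    · exact ⟨(hiid h).1, (hiid h).2.1, (hiid h).2.2.1⟩
    · exact ⟨(hsw h).1, (hsw h).2.1, (hsw h).2.2.1⟩
  · intro h
    obtain ⟨-, -, h3, h4⟩ := hiid h
    rw [h3, Finset.sum_eq_zero fun l hl ↦ ?_, mul_zero, add_zero]
    rw [(h4 l hl).2.2, integral_inner_prod (memLp_crossLp hH hk_cont hφ (hμ t) b), sub_self,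
      mul_zero]
  · intro h _ hres
    refine ⟨aeval_Fpoly_of_isUnit m hm _ (by simpa [spectrum.mem_resolventSet_iff] using hres), ?_⟩
    intro ι e lam he
    obtain ⟨-, -, h3, h4⟩ := hsw h
    obtain ⟨F, hF⟩ := he.exists_hilbertBasis hH hk_cont hcomp
    have : TopologicalSpace.SeparableSpace H := separableSpace_of_continuous hH hk_cont
    -- Countability of the index set is needed for termwise integration.
    have : Countable ι := countable_of_orthonormal F.orthonormal
    have hg := memLp_gFun hH hk_cont hφ F hF (hμ t)
    have hg' := memLp_gStarFun hH hk_cont hφ F hF (hμ t)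
    -- A finite weighted sum over lags of convergent double series; the weights and the powers l - 1
    -- assemble to F_m(K₀). Unconditional convergence in ℝ is absolute convergence.
    have hsum := (hasSum_sum fun l (hl : l ∈ Finset.Ico 1 m) ↦
      (hasSum_covariance hH hk_cont hφ F hF b hμ t (l - 1) (h4 l hl).1 (h4 l hl).2.1
        hg hg').mul_left (((m : ℝ) - l) / m)).mul_left 2
    simp only [← inner_aeval_Fpoly] at hsum
    refine ⟨hg, hg', hsum.summable, ?_⟩
    rw [h3, hsum.tsum_eq]
    congr 3
    exact Finset.sum_congr rfl fun l hl ↦ by rw [(h4 l hl).2.2]
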